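/- **The $\sigma$-bounded recycling Bloom filter: Markov model and long-run false-positive rate.** Let $1\le k\le\sigma<M$. A filter has $M$ bits, all initially $0$. New (pairwise distinct) messages arrive one after the other. Each hashes to $k$ positions, independently of the other messages: *colliding* means that the $k$ positions are independent and uniform (sampling with replacement), *non-colliding* that they are a uniformly random sequence of $k$ distinct positions (sampling without replacement). A new message is a *false positive* if all its positions are already set on arrival. The positions of the message are then set to $1$; if more than $\sigma$ bits are set after this, the filter is recycled, i.e. all bits are cleared. A *non-retaining* filter then drops the message, and a *retaining* one re-inserts it as the first message of the new cycle, either *rehashed* (with fresh independent hash positions of the same law) or *kept* (at its old positions). All the statements for retaining filters hold for both readings, except where one of them is named. Let $B_t$ be the number of set bits after $t$ new messages. Let $\tau_k(i,j)$ be the probability that one new message with $k$ hashes takes the filter from $i$ to $j$ set bits ($0\le i,j\le\sigma$); for $k=0$ nothing is set. Write $\tau^{cn},\tau^{cr},\tau^{nn},\tau^{nr}$ for colliding/non-colliding ($c/n$) and non-retaining/retaining ($n/r$). Below $0\le i,j\le\sigma$. 1. *Well-definedness.* For every set $S$ of at most $\sigma$ bits, the probability that a new message takes the filter from the set $S$ of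 set bits to a state with $j$ set bits depends on $S$ only through $|S|$, so it is $\tau_k(|S|,j)$; and $\sum_{j=0}^{\sigma}\tau_k(i,j)=1$. 2. *Base cases, all versions.* $\tau_0(i,j)=I_{i=j}$, $\tau_k(0,0)=0$, and $\tau_k(i,j)=0$ for $j>i+k$. In both non-colliding versions $\tau_k(0,k)=1$. 3. *Forward recursion.* For $j\ge i$, $j\ge1$, in the non-retaining versions, and in the retaining versions if $2k\le\sigma$, $$\tau_k(i,j)=\tau_{k-1}(i,j)\tfrac{j}{M}+\tau_{k-1}(i,j-1)\tfrac{M-j+1}{M}\quad\text{(colliding)},$$ $$\tau_k(i,j)=\tau_{k-1}(i,j)\tfrac{j-(k-1)}{M-(k-1)}+\tau_{k-1}(i,j-1)\tfrac{M-j+1}{M-(k-1)}\quad\text{(non-colliding)}.$$ 4. *Backward transitions, non-retaining.* For $i\ge1$, $$\tau^{cn}_k(i,0)=\tau^{cn}_{k-1}(i,0)+\tau^{cn}_{k-1}(i,\sigma)\tfrac{M-\sigma}{M},\qquad \tau^{nn}_k(i,0)=\tau^{nn}_{k-1}(i,0)+\tau^{nn}_{k-1}(i,\sigma)\tfrac{M-\sigma}{M-(k-1)},$$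 and in both versions $\tau_k(i,j)=0$ for $0<j<i$. 5. *Backward transitions, retaining.* In both retaining versions $\tau_k(i,0)=0$, $\tau_k(i,j)=0$ for $k<j<i$, and, if $2k\le\sigma$, $\tau_k(i,j)=0$ for $j<i\le k$. For $j\le k<i$: in the colliding case $$\tau^{cr}_k(i,j)=\tau^{cn}_k(i,0)\,\tau^{cn}_k(0,j)\ \text{ (rehashed)},\qquad \tau^{cr}_k(i,j)=\tau^{nn}_j(i,0)\,\tau^{cn}_k(0,j)\ \text{ (kept)};$$ in the non-colliding case $\tau^{nr}_k(i,k)=\tau^{nn}_k(i,0)$ and $\tau^{nr}_k(i,j)=0$ for $j<k$. 6. *Markov chain and long-run rate.* In every version, $(B_t)_{t\ge0}$ is a Markov chain on $\{0,\dots,\sigma\}$ with transition probabilities $\tau_k(i,j)$. The probability that a new message which finds $i$ set bits is a false positive is $$\rho(i)=(i/M)^k\ \text{ (colliding)},\qquad \rho(i)=\binom ik\Big/\binom Mk\ \text{ (non-colliding)}.$$ There is exactly one stationary distribution $\pi$ of $\tau_k$ on $\{0,\dots,\sigma\}$, and $P(B_t=i)\to\pi_i$ as $t\to\infty$ for every $i$.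 Almost surely, the fraction of false positives among the first $n$ new messages converges, as $n\to\infty$, to $$f_\sigma^1=\sum_{i=0}^{\sigma}\pi_i\,\rho(i).$$ -/

import Mathlib

open MeasureTheory ProbabilityTheory Filter Topology

noncomputable section

namespace RBF

/-- How the `k` hash positions of one message are sampled from the `M` bits: with replacement
(`colliding`) or without replacement (`nonColliding`). -/
inductive Scheme
  | colliding
  | nonColliding

/-- What happens to the message that triggers a recycling, after all bits are cleared:
* `forget`: it is dropped (non-retaining filter);
* `keep`: it is re-inserted, at the same positions as before (retaining filter);
* `rehash`: it is re-inserted, hashed afresh for the new cycle (retaining filter). -/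
inductive Recycle
  | forget
  | keep
  | rehash

/-- The possible sequences of `k` hash positions. -/
def hashes (c : Scheme) (M k : ℕ) : Finset (Fin k → Fin M) :=
  open Classical in
  match c with
  | .colliding => Finset.univ
  | .nonColliding => Finset.univ.filter Function.Injective

variable {M k : ℕ}

/-- The set of bits to which a message hashes. -/
def positions (h : Fin k → Fin M) : Finset (Fin M) := Finset.univ.image h

/-- The set of bits that are `1` after the arrival of a new message with hash positions `h` at a
filter whose set of `1` bits is `S`; `h'` are the hash positions of this message after a
recycling, relevant for `Recycle.rehash` only. -/
def step (σ : ℕ) (r : Recycle) (S : Finset (Fin M)) (h h' : Fin k → Fin M) : Finset (Fin M) :=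
  if (S ∪ positions h).card ≤ σ then S ∪ positions h
  else match r with
    | .forget => ∅
    | .keep => positions h
    | .rehash => positions h'

/-- The set of `1` bits after `t` new messages. The `u`-th message (`u = 0, 1, …`) has hash
positions `H u 0`, and hash positions `H u 1` if it is hashed afresh after a recycling. -/
def bits (σ : ℕ) (r : Recycle) (H : ℕ → Fin 2 → Fin k → Fin M) : ℕ → Finset (Fin M)
  | 0 => ∅
  | t + 1 => step σ r (bits σ r H t) (H t 0) (H t 1)

/-- The new message `t` is a false positive: all its bits are already set on arrival. -/
def IsFalsePositive (σ : ℕ) (r : Recycle) (H : ℕ → Fin 2 → Fin k → Fin M) (t : ℕ) : Prop :=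
  positions (H t 0) ⊆ bits σ r H t

/-- The fraction of false positives among the first `n` new messages. -/
def falsePositiveFraction (σ : ℕ) (r : Recycle) (H : ℕ → Fin 2 → Fin k → Fin M) (n : ℕ) : ℝ :=
  open Classical in
  (((Finset.range n).filter (IsFalsePositive σ r H)).card : ℝ) / n

/-- The probability that one new message with `k` hashes takes the filter from the set `S` of `1`
bits to a set of `j` bits. -/
def moveProb (c : Scheme) (r : Recycle) (σ k : ℕ) (S : Finset (Fin M)) (j : ℕ) : ℝ :=
  (((hashes c M k ×ˢ hashes c M k).filter fun p => (step σ r S p.1 p.2).card = j).card : ℝ) /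
    ((hashes c M k ×ˢ hashes c M k).card : ℝ)

/-- The transition probability `τ_k(i,j)`: one new message with `k` hashes takes the filter from
`i` set bits to `j` set bits. It is computed from the set of the first `i` bits. -/
def tau (c : Scheme) (r : Recycle) (M σ k i j : ℕ) : ℝ :=
  moveProb c r σ k (Finset.univ.filter fun x : Fin M => (x : ℕ) < i) j

/-- `ρ(i)`: the false-positive rate in the state with `i` set bits. -/
def rho (c : Scheme) (M k i : ℕ) : ℝ :=
  match c with
  | .colliding => ((i : ℝ) / M) ^ k
  | .nonColliding => (i.choose k : ℝ) / (M.choose k : ℝ)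

/-- `X` is a (time-homogeneous) Markov chain under `μ` with transition probabilities `P`:
`P(X_{t+1} = j, X_0 = s_0, …, X_t = s_t) = P(X_0 = s_0, …, X_t = s_t) P(s_t, j)`. -/
def IsMarkovChain {Ω : Type*} [MeasurableSpace Ω] (μ : Measure Ω) (X : ℕ → Ω → ℕ)
    (P : ℕ → ℕ → ℝ) : Prop :=
  ∀ (t : ℕ) (s : ℕ → ℕ) (j : ℕ),
    μ.real {ω | X (t + 1) ω = j ∧ ∀ u ≤ t, X u ω = s u} =
      μ.real {ω | ∀ u ≤ t, X u ω = s u} * P (s t) j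

/-- `π` is a stationary distribution of `P` on the states `0, …, σ`. -/
def IsStationary {σ : ℕ} (P : ℕ → ℕ → ℝ) (π : Fin (σ + 1) → ℝ) : Prop :=
  (∀ i, 0 ≤ π i) ∧ ∑ i, π i = 1 ∧ ∀ j : Fin (σ + 1), ∑ i, π i * P i j = π j

end RBF

end

/-!
The transition law depends on the set `S` of set bits only through its size because a permutation
of the positions permutes the hash sequences (`moveProb_congr_card`). A move to `j` set bits either
happens without a recycling, or leaves at most `k` bits set. Where the second case is impossible,
the transition probability is the probability that `S` and `k` random positions together occupy `j`
bits, and the recursions follow by conditioning on the first `k - 1` hashes (`hashProb_card_succ`,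
`hashProb_lt_card_succ`). For retaining filters with colliding hashes that keep their positions,
the decisive fact is that, given their number `j`, the occupied positions form a uniformly random
set of `j` positions, the same as `j` non-colliding hashes produce (`hashProb_colliding_and`).

For the long run, every state `i` can move to `min σ (max (i + 1) k)` without a recycling, so that
after `σ` messages the state `σ` has positive probability whatever the start
(`transition_pow_pos`). By Doeblin's argument (`sum_abs_vecMul_le`) the transition matrix `P` then
contracts row vectors of mass zero, which yields a unique stationary distribution `π`, convergence
of the law, and the solvability of the Poisson equation `g - P g = ρ - π(ρ)` (`exists_poisson`).

The hashes of the message `t` are independent of the past and may be averaged out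
(`integral_eq_integral_hashAvg`). This gives the Markov property and the false-positive rate in a
given state, and it shows that the variables
`1[message t is a false positive] - π(ρ) + g(B_{t+1}) - g(B_t)` are orthogonal. A strong law of
large numbers for bounded orthogonal variables (`ae_tendsto_average_of_orthogonal`) applies to
them, and the increments of `g` telescope.
-/

namespace RBF


/-! ### Finite Markov chains with a state that is accessible from everywhere -/

section FiniteChain

variable {n : Type*} [Fintype n] [DecidableEq n] {P : Matrix n n ℝ}

open Matrix

lemma sum_vecMul_of_mem_rowStochastic (hP : P ∈ rowStochastic ℝ n) (w : n → ℝ) :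
    ∑ j, (w ᵥ* P) j = ∑ i, w i := by
  simp only [vecMul, dotProduct]
  rw [Finset.sum_comm]
  simp [← Finset.mul_sum, sum_row_of_mem_rowStochastic hP]

/-- Doeblin's contraction: if the column `s` of a stochastic matrix is bounded below by `ε`, then
the matrix contracts the `ℓ¹` norm of row vectors of total mass zero by the factor `1 - ε`. -/
lemma sum_abs_vecMul_le (hP : P ∈ rowStochastic ℝ n) {s : n} {ε : ℝ} (hε : ∀ i, ε ≤ P i s)
    {w : n → ℝ} (hw : ∑ i, w i = 0) :
    ∑ j, |(w ᵥ* P) j| ≤ (1 - ε) * ∑ i, |w i| := by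
  -- Since `w` has mass zero, `ε` may be subtracted from the column `s` without changing `w ᵥ* P`.
  have key : ∀ j, (w ᵥ* P) j = ∑ i, w i * (P i j - if j = s then ε else 0) := by
    intro j
    simp only [mul_sub, Finset.sum_sub_distrib, ← Finset.sum_mul, hw, zero_mul, sub_zero]
    rfl
  have hR : ∀ i j, 0 ≤ P i j - if j = s then ε else 0 := by
    intro i j
    split_ifs with h
    · subst h
      linarith [hε i]
    · simpa using nonneg_of_mem_rowStochastic hP
  calc ∑ j, |(w ᵥ* P) j|
      ≤ ∑ j, ∑ i, |w i| * (P i j - if j = s then ε else 0) := by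
        refine Finset.sum_le_sum fun j _ => ?_
        rw [key]
        refine (Finset.abs_sum_le_sum_abs _ _).trans_eq ?_
        exact Finset.sum_congr rfl fun i _ => by rw [abs_mul, abs_of_nonneg (hR i j)]
    _ = (1 - ε) * ∑ i, |w i| := by
        rw [Finset.sum_comm, Finset.mul_sum]
        refine Finset.sum_congr rfl fun i _ => ?_
        rw [← Finset.mul_sum, Finset.sum_sub_distrib, sum_row_of_mem_rowStochastic hP]
        simp [mul_comm]

lemma tendsto_sum_abs_vecMul_pow (hP : P ∈ rowStochastic ℝ n) {N : ℕ} {s : n}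
    (hN : ∀ i, 0 < (P ^ N) i s) {w : n → ℝ} (hw : ∑ i, w i = 0) :
    Tendsto (fun t => ∑ j, |(w ᵥ* P ^ t) j|) atTop (𝓝 0) := by
  have hPt : ∀ t, P ^ t ∈ rowStochastic ℝ n := fun t => pow_mem hP t
  set a : ℕ → ℝ := fun t => ∑ j, |(w ᵥ* P ^ t) j| with ha
  have hanti : Antitone a := by
    refine antitone_nat_of_succ_le fun t => ?_
    have h := sum_abs_vecMul_le hP (s := s) (ε := 0) (fun i => nonneg_of_mem_rowStochastic hP)
      (w := w ᵥ* P ^ t) (by rw [sum_vecMul_of_mem_rowStochastic (hPt t), hw])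
    simpa [ha, pow_succ, vecMul_vecMul] using h
  obtain ⟨i₀, -, hi₀⟩ := Finset.exists_min_image Finset.univ (fun i => (P ^ N) i s)
    ⟨s, Finset.mem_univ s⟩
  set ε := (P ^ N) i₀ s
  have hε0 : 0 < ε := hN i₀
  have hε1 : ε ≤ 1 := le_one_of_mem_rowStochastic (hPt N)
  have hgeo : ∀ m, a (N * m) ≤ (1 - ε) ^ m * a 0 := by
    intro m
    induction m with
    | zero => simp
    | succ m ih =>
      have h := sum_abs_vecMul_le (hPt N) (s := s) (ε := ε) (fun i => hi₀ i (Finset.mem_univ i))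
        (w := w ᵥ* P ^ (N * m)) (by rw [sum_vecMul_of_mem_rowStochastic (hPt _), hw])
      rw [vecMul_vecMul, ← pow_add] at h
      calc a (N * (m + 1)) ≤ (1 - ε) * a (N * m) := h
        _ ≤ (1 - ε) * ((1 - ε) ^ m * a 0) := by gcongr
        _ = _ := by ring
  have h0 : ∀ t, 0 ≤ a t := fun t => Finset.sum_nonneg fun _ _ => abs_nonneg _
  -- The norms decrease, so their geometric decay along the multiples of `N` suffices.
  have hlim : Tendsto (fun m => (1 - ε) ^ m * a 0) atTop (𝓝 0) := by
    simpa using (tendsto_pow_atTop_nhds_zero_of_lt_one (by linarith)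
      (by linarith : 1 - ε < 1)).mul_const (a 0)
  rw [Metric.tendsto_atTop]
  intro δ hδ
  obtain ⟨m, hm⟩ := (hlim.eventually (gt_mem_nhds hδ)).exists
  refine ⟨N * m, fun t ht => ?_⟩
  rw [Real.dist_eq, sub_zero, abs_of_nonneg (h0 t)]
  exact (hanti ht).trans_lt ((hgeo m).trans_lt hm)

/-- An invariant row vector of total mass zero vanishes. -/
lemma eq_zero_of_vecMul_eq_self (hP : P ∈ rowStochastic ℝ n) {N : ℕ} {s : n}
    (hN : ∀ i, 0 < (P ^ N) i s) {w : n → ℝ} (hw : ∑ i, w i = 0) (h : w ᵥ* P = w) : w = 0 := by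
  have hfix : ∀ t : ℕ, w ᵥ* P ^ t = w := by
    intro t
    induction t with
    | zero => simp
    | succ t ih => rw [pow_succ, ← vecMul_vecMul, ih, h]
  have hlim := tendsto_sum_abs_vecMul_pow hP hN hw
  simp only [hfix] at hlim
  have h0 : ∑ j, |w j| = 0 := tendsto_nhds_unique tendsto_const_nhds hlim
  ext j
  simpa using (Finset.sum_eq_zero_iff_of_nonneg fun j _ => abs_nonneg (w j)).1 h0 j
    (Finset.mem_univ j)

lemma tendsto_vecMul_pow (hP : P ∈ rowStochastic ℝ n) {N : ℕ} {s : n}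
    (hN : ∀ i, 0 < (P ^ N) i s) {w p : n → ℝ} (hw : ∑ i, w i = 1) (hwP : w ᵥ* P = w)
    (hp : ∑ i, p i = 1) (j : n) : Tendsto (fun t => (p ᵥ* P ^ t) j) atTop (𝓝 (w j)) := by
  have hfix : ∀ t : ℕ, w ᵥ* P ^ t = w := by
    intro t
    induction t with
    | zero => simp
    | succ t ih => rw [pow_succ, ← vecMul_vecMul, ih, hwP]
  have hlim := tendsto_sum_abs_vecMul_pow hP hN (w := p - w) (by simp [hw, hp])
  rw [tendsto_iff_dist_tendsto_zero]
  refine squeeze_zero (fun t => dist_nonneg) (fun t => ?_) hlim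
  rw [Real.dist_eq]
  have h := Finset.single_le_sum (f := fun j => |((p - w) ᵥ* P ^ t) j|)
    (fun i _ => abs_nonneg _) (Finset.mem_univ j)
  simpa [sub_vecMul, hfix t] using h

/-- A stochastic matrix has a nonzero invariant row vector because `P - 1` kills the constant
column vector and is therefore singular. The contraction shows that its mass does not vanish, and
the convergence of the powers that its normalisation is nonnegative. -/
lemma exists_stationary (hP : P ∈ rowStochastic ℝ n) {N : ℕ} {s : n}
    (hN : ∀ i, 0 < (P ^ N) i s) :
    ∃ w : n → ℝ, (∀ i, 0 ≤ w i) ∧ ∑ i, w i = 1 ∧ w ᵥ* P = w := by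
  have hdet : (P - 1).det = 0 := by
    rw [← exists_mulVec_eq_zero_iff]
    refine ⟨1, fun h => one_ne_zero (congrFun h s), ?_⟩
    rw [sub_mulVec, one_mulVec, one_vecMul_of_mem_rowStochastic hP, sub_self]
  obtain ⟨v, hv0, hv⟩ := exists_vecMul_eq_zero_iff.2 hdet
  rw [vecMul_sub, vecMul_one, sub_eq_zero] at hv
  have hmass : ∑ i, v i ≠ 0 := fun h => hv0 (eq_zero_of_vecMul_eq_self hP hN h hv)
  set w : n → ℝ := (∑ i, v i)⁻¹ • v with hw
  have hw1 : ∑ i, w i = 1 := by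
    simp only [hw, Pi.smul_apply, smul_eq_mul, ← Finset.mul_sum]
    exact inv_mul_cancel₀ hmass
  have hwP : w ᵥ* P = w := by rw [hw, smul_vecMul, hv]
  refine ⟨w, fun j => ?_, hw1, hwP⟩
  refine ge_of_tendsto' (tendsto_vecMul_pow hP hN (p := Pi.single s 1) hw1 hwP (by simp) j)
    fun t => ?_
  refine nonneg_vecMul_of_mem_rowStochastic (pow_mem hP t) (fun i => ?_) j
  by_cases h : i = s
  · subst h; simp
  · simp [h]

/-- The Poisson equation `g - P g = f - π(f)` is solvable: the matrix `1 - P + 1 πᵀ` has trivial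
left kernel, and any preimage `g` of `f` under it satisfies `π(g) = π(f)`. -/
lemma exists_poisson (hP : P ∈ rowStochastic ℝ n) {N : ℕ} {s : n}
    (hN : ∀ i, 0 < (P ^ N) i s) {w : n → ℝ} (hw : ∑ i, w i = 1) (hwP : w ᵥ* P = w)
    (f : n → ℝ) :
    ∃ g : n → ℝ, ∀ i, g i - ∑ j, P i j * g j = f i - ∑ j, w j * f j := by
  set A : Matrix n n ℝ := 1 - P + vecMulVec 1 w with hA
  have hvA : ∀ v : n → ℝ, v ᵥ* A = v - v ᵥ* P + (∑ i, v i) • w := by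
    intro v
    rw [hA, vecMul_add, vecMul_sub, vecMul_one, vecMul_vecMulVec]
    simp [dotProduct]
  have hinj : Function.Injective A.vecMul := by
    suffices h : ∀ v, v ᵥ* A = 0 → v = 0 by
      intro u v huv
      have : (u - v) ᵥ* A = 0 := by
        rw [sub_vecMul, sub_eq_zero]
        exact huv
      exact sub_eq_zero.1 (h _ this)
    intro v hv
    rw [hvA] at hv
    have hmass : ∑ i, v i = 0 := by
      have h := congrArg (fun u : n → ℝ => ∑ i, u i) hv
      simpa [Finset.sum_add_distrib, sum_vecMul_of_mem_rowStochastic hP, ← Finset.mul_sum, hw]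
        using h
    refine eq_zero_of_vecMul_eq_self hP hN hmass ?_
    rw [hmass, zero_smul, add_zero, sub_eq_zero] at hv
    exact hv.symm
  obtain ⟨g, hg⟩ := mulVec_surjective_iff_isUnit.2 (vecMul_injective_iff_isUnit.1 hinj) f
  have hwA : w ᵥ* A = w := by rw [hvA, hwP, hw]; simp
  have hmean : w ⬝ᵥ g = w ⬝ᵥ f := by rw [← hg, dotProduct_mulVec, hwA]
  refine ⟨g, fun i => ?_⟩
  have hi := congrFun hg i
  rw [hA, add_mulVec, sub_mulVec, one_mulVec, vecMulVec_mulVec] at hi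
  simp only [Pi.add_apply, Pi.sub_apply, Pi.smul_apply, Pi.one_apply, hmean] at hi
  simp only [mulVec, dotProduct, MulOpposite.smul_eq_mul_unop, MulOpposite.unop_op, one_mul] at hi
  linarith

/-- If every state `i` can move to `next i` and iterating `next` leads to `s`, then `s` is reached
with positive probability from everywhere. -/
lemma pow_apply_iterate_pos (hP : P ∈ rowStochastic ℝ n) {next : n → n}
    (hnext : ∀ i, 0 < P i (next i)) (m : ℕ) (i : n) : 0 < (P ^ m) i (next^[m] i) := by
  induction m with
  | zero => simp
  | succ m ih =>
    rw [pow_succ, mul_apply, Function.iterate_succ_apply']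
    refine (mul_pos ih (hnext (next^[m] i))).trans_le ?_
    exact Finset.single_le_sum (f := fun j => (P ^ m) i j * P j (next (next^[m] i)))
      (fun j _ => mul_nonneg (nonneg_of_mem_rowStochastic (pow_mem hP m))
        (nonneg_of_mem_rowStochastic hP)) (Finset.mem_univ _)

end FiniteChain


/-! ### A strong law of large numbers for bounded orthogonal random variables -/

section StrongLaw

lemma abs_sum_range_le {Ω : Type*} {D : ℕ → Ω → ℝ} {C : ℝ}
    (hC : ∀ t ω, |D t ω| ≤ C) (n : ℕ) (ω : Ω) :
    |∑ t ∈ Finset.range n, D t ω| ≤ n * C := by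
  refine (Finset.abs_sum_le_sum_abs _ _).trans ?_
  simpa using Finset.sum_le_sum fun t (_ : t ∈ Finset.range n) => hC t ω

variable {Ω : Type*} [MeasurableSpace Ω] {μ : Measure Ω} [IsProbabilityMeasure μ]

lemma integrable_of_abs_le {f : Ω → ℝ} (hf : Measurable f) {C : ℝ} (hC : ∀ ω, |f ω| ≤ C) :
    Integrable f μ :=
  Integrable.of_bound hf.aestronglyMeasurable C (ae_of_all _ hC)

variable {D : ℕ → Ω → ℝ} {C : ℝ}

lemma integral_sq_sum_le_of_orthogonal (hm : ∀ t, Measurable (D t)) (hC : ∀ t ω, |D t ω| ≤ C)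
    (horth : ∀ s t, s < t → ∫ ω, D s ω * D t ω ∂μ = 0) (n : ℕ) :
    ∫ ω, (∑ t ∈ Finset.range n, D t ω) ^ 2 ∂μ ≤ n * C ^ 2 := by
  have hprod : ∀ s t, Integrable (fun ω => D s ω * D t ω) μ := fun s t =>
    integrable_of_abs_le ((hm s).mul (hm t)) (C := C * C) fun ω => by
      rw [abs_mul]
      exact mul_le_mul (hC s ω) (hC t ω) (abs_nonneg _) ((abs_nonneg _).trans (hC s ω))
  have hsq : ∀ n, Integrable (fun ω => (∑ t ∈ Finset.range n, D t ω) ^ 2) μ := fun n =>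
    integrable_of_abs_le ((Finset.measurable_fun_sum _ fun t _ => hm t).pow_const 2)
      (C := (n * C) ^ 2) fun ω => by
        rw [abs_pow]
        exact pow_le_pow_left₀ (abs_nonneg _) (abs_sum_range_le hC n ω) 2
  induction n with
  | zero => simp
  | succ n ih =>
    have hexp : ∀ ω, (∑ t ∈ Finset.range (n + 1), D t ω) ^ 2 =
        (∑ t ∈ Finset.range n, D t ω) ^ 2 + 2 * ∑ s ∈ Finset.range n, D s ω * D n ω +
          D n ω * D n ω := by
      intro ω
      rw [Finset.sum_range_succ, ← Finset.sum_mul]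
      ring
    have hcross : Integrable (fun ω => 2 * ∑ s ∈ Finset.range n, D s ω * D n ω) μ :=
      (integrable_finsetSum _ fun s _ => hprod s n).const_mul 2
    have hadd : Integrable (fun ω => (∑ t ∈ Finset.range n, D t ω) ^ 2 +
        2 * ∑ s ∈ Finset.range n, D s ω * D n ω) μ := (hsq n).add hcross
    simp only [hexp]
    rw [integral_add hadd (hprod n n), integral_add (hsq n) hcross, integral_const_mul,
      integral_finsetSum _ fun s _ => hprod s n,
      Finset.sum_eq_zero fun s hs => horth s n (Finset.mem_range.1 hs)]
    have hlast : ∫ ω, D n ω * D n ω ∂μ ≤ C ^ 2 := by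
      have h := integral_mono (hprod n n) (integrable_const (C ^ 2)) fun ω => by
        show D n ω * D n ω ≤ C ^ 2
        rw [← sq, ← sq_abs]
        exact pow_le_pow_left₀ (abs_nonneg _) (hC n ω) 2
      simpa using h
    push_cast
    linarith

lemma ae_tendsto_sum_sq_div_sq (hm : ∀ t, Measurable (D t)) (hC : ∀ t ω, |D t ω| ≤ C)
    (horth : ∀ s t, s < t → ∫ ω, D s ω * D t ω ∂μ = 0) :
    ∀ᵐ ω ∂μ, Tendsto (fun m : ℕ => (∑ t ∈ Finset.range (m ^ 2), D t ω) / (m : ℝ) ^ 2)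
      atTop (𝓝 0) := by
  set Z : ℕ → Ω → ℝ := fun m ω => (∑ t ∈ Finset.range (m ^ 2), D t ω) / (m : ℝ) ^ 2 with hZ
  have hZm : ∀ m, Measurable (Z m) := fun m =>
    (Finset.measurable_fun_sum _ fun t _ => hm t).div_const _
  have hZint : ∀ m, Integrable (fun ω => Z m ω ^ 2) μ := fun m =>
    integrable_of_abs_le ((hZm m).pow_const 2)
      (C := (((m ^ 2 : ℕ) : ℝ) * C / (m : ℝ) ^ 2) ^ 2) fun ω => by
        rw [abs_pow]
        refine pow_le_pow_left₀ (abs_nonneg _) ?_ 2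
        rw [hZ, abs_div, abs_of_nonneg (by positivity : (0 : ℝ) ≤ (m : ℝ) ^ 2)]
        gcongr
        exact abs_sum_range_le hC _ ω
  have hle : ∀ m, ∫ ω, Z m ω ^ 2 ∂μ ≤ C ^ 2 * (1 / (m : ℝ) ^ 2) := by
    intro m
    simp only [hZ, div_pow]
    rw [integral_div]
    rcases Nat.eq_zero_or_pos m with rfl | hpos
    · simp
    have hpos' : (0 : ℝ) < m := by exact_mod_cast hpos
    rw [div_le_iff₀ (by positivity)]
    refine (integral_sq_sum_le_of_orthogonal hm hC horth _).trans_eq ?_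
    push_cast
    field_simp
  have hsum : Summable fun m : ℕ => C ^ 2 * (1 / (m : ℝ) ^ 2) :=
    (Real.summable_one_div_nat_pow.2 one_lt_two).mul_left _
  have hfin : ∫⁻ ω, ∑' m, ENNReal.ofReal (Z m ω ^ 2) ∂μ ≠ ⊤ := by
    rw [lintegral_tsum fun m => ((hZm m).pow_const 2).ennreal_ofReal.aemeasurable]
    refine ne_top_of_le_ne_top hsum.tsum_ofReal_ne_top (ENNReal.tsum_le_tsum fun m => ?_)
    rw [← ofReal_integral_eq_lintegral_ofReal (hZint m) (ae_of_all _ fun ω => sq_nonneg _)]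
    exact ENNReal.ofReal_le_ofReal (hle m)
  filter_upwards [ae_lt_top (Measurable.tsum fun m =>
    ((hZm m).pow_const 2).ennreal_ofReal) hfin] with ω hω
  have h1 := ENNReal.tendsto_atTop_zero_of_tsum_ne_top hω.ne
  have h2 : Tendsto (fun m => Z m ω ^ 2) atTop (𝓝 0) := by
    have h := (ENNReal.tendsto_toReal ENNReal.zero_ne_top).comp h1
    refine h.congr fun m => ?_
    simp [ENNReal.toReal_ofReal (sq_nonneg _)]
  have h3 := h2.sqrt
  simp only [Real.sqrt_sq_eq_abs, Real.sqrt_zero] at h3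
  exact (tendsto_zero_iff_abs_tendsto_zero _).2 h3

/-- The averages of bounded, pairwise orthogonal random variables tend to zero almost surely: the
second moments of the averages over `m ^ 2` terms are summable, and bounded terms cannot change an
average much between consecutive squares. -/
theorem ae_tendsto_average_of_orthogonal (hm : ∀ t, Measurable (D t))
    (hC : ∀ t ω, |D t ω| ≤ C) (horth : ∀ s t, s < t → ∫ ω, D s ω * D t ω ∂μ = 0) :
    ∀ᵐ ω ∂μ, Tendsto (fun n : ℕ => (∑ t ∈ Finset.range n, D t ω) / (n : ℝ)) atTop (𝓝 0) := by
  filter_upwards [ae_tendsto_sum_sq_div_sq hm hC horth] with ω hω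
  have hC0 : 0 ≤ C := (abs_nonneg _).trans (hC 0 ω)
  have hroot : Tendsto Nat.sqrt atTop atTop :=
    tendsto_atTop_atTop.2 fun b => ⟨b ^ 2, fun a ha => Nat.le_sqrt'.2 ha⟩
  have hinv : Tendsto (fun m : ℕ => 2 * C * (1 / (m : ℝ))) atTop (𝓝 0) := by
    simpa using tendsto_one_div_atTop_nhds_zero_nat.const_mul (2 * C)
  have hbound := (hω.abs.add hinv).comp hroot
  simp only [abs_zero, add_zero] at hbound
  refine squeeze_zero_norm' ?_ hbound
  filter_upwards [eventually_gt_atTop 0] with n hn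
  set m := Nat.sqrt n with hmdef
  have hm0 : 0 < m := Nat.sqrt_pos.2 hn
  have hmn : m ^ 2 ≤ n := Nat.sqrt_le' n
  -- Between `m ^ 2` and `n` there are at most `2 * m` terms.
  have hnm : n ≤ m ^ 2 + 2 * m := by
    have h := Nat.lt_succ_sqrt' n
    rw [← hmdef, Nat.succ_eq_add_one] at h
    linarith [show (m + 1) ^ 2 = m ^ 2 + 2 * m + 1 by ring]
  have hm0' : (0 : ℝ) < m := by exact_mod_cast hm0
  have hmn' : (m : ℝ) ^ 2 ≤ n := by exact_mod_cast hmn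
  have hnm' : (n : ℝ) ≤ (m : ℝ) ^ 2 + 2 * m := by exact_mod_cast hnm
  have hsplit : ∑ t ∈ Finset.range n, D t ω =
      ∑ t ∈ Finset.range (m ^ 2), D t ω + ∑ t ∈ Finset.Ico (m ^ 2) n, D t ω :=
    (Finset.sum_range_add_sum_Ico _ hmn).symm
  have htail : |∑ t ∈ Finset.Ico (m ^ 2) n, D t ω| ≤ 2 * m * C := by
    refine (Finset.abs_sum_le_sum_abs _ _).trans ?_
    refine (Finset.sum_le_sum fun t _ => hC t ω).trans ?_
    rw [Finset.sum_const, Nat.card_Ico, nsmul_eq_mul, Nat.cast_sub hmn]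
    push_cast
    gcongr
    linarith
  rw [Real.norm_eq_abs, abs_div, Nat.abs_cast]
  calc |∑ t ∈ Finset.range n, D t ω| / (n : ℝ)
      ≤ (|∑ t ∈ Finset.range (m ^ 2), D t ω| + 2 * m * C) / (m : ℝ) ^ 2 := by
        rw [hsplit]
        gcongr
        exact (abs_add_le _ _).trans (by gcongr)
    _ = |(∑ t ∈ Finset.range (m ^ 2), D t ω) / (m : ℝ) ^ 2| + 2 * C * (1 / (m : ℝ)) := by
        rw [abs_div, abs_of_nonneg (by positivity : (0 : ℝ) ≤ (m : ℝ) ^ 2)]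
        field_simp

end StrongLaw


/-! ### Hash sequences and their symmetry -/

section Hashes

variable {c : Scheme} {r : Recycle} {M k σ : ℕ}

@[simp] lemma mem_hashes_colliding (h : Fin k → Fin M) : h ∈ hashes .colliding M k := by
  simp [hashes]

@[simp] lemma mem_hashes_nonColliding {h : Fin k → Fin M} :
    h ∈ hashes .nonColliding M k ↔ Function.Injective h := by
  simp [hashes]

lemma mem_hashes_of_injective {h : Fin k → Fin M} (hh : Function.Injective h) :
    h ∈ hashes c M k := by
  cases c <;> simp [hh]

lemma hashes_nonempty (hkM : k ≤ M) : (hashes c M k).Nonempty :=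
  ⟨Fin.castLE hkM, mem_hashes_of_injective (Fin.castLE_injective hkM)⟩

lemma card_hashes_pos (hkM : k ≤ M) : (0 : ℝ) < (hashes c M k).card := by
  exact_mod_cast (hashes_nonempty hkM).card_pos

lemma card_positions_le (h : Fin k → Fin M) : (positions h).card ≤ k := by
  simpa [positions] using Finset.card_image_le (s := Finset.univ) (f := h)

lemma card_positions_of_injective {h : Fin k → Fin M} (hh : Function.Injective h) :
    (positions h).card = k := by
  simpa [positions] using Finset.card_image_of_injective Finset.univ hh

lemma card_positions_of_mem_nonColliding {h : Fin k → Fin M} (hh : h ∈ hashes .nonColliding M k) :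
    (positions h).card = k :=
  card_positions_of_injective (mem_hashes_nonColliding.1 hh)

lemma injective_iff_card_positions {h : Fin k → Fin M} :
    Function.Injective h ↔ (positions h).card = k := by
  refine ⟨card_positions_of_injective, fun hh => ?_⟩
  have := Finset.card_image_iff.1 (hh.trans (Finset.card_fin k).symm)
  simpa [Set.injOn_univ] using this

lemma card_positions_pos (hk : 1 ≤ k) (h : Fin k → Fin M) : 0 < (positions h).card :=
  Finset.card_pos.2 ⟨h ⟨0, hk⟩, Finset.mem_image_of_mem h (Finset.mem_univ _)⟩

lemma card_union_positions_le (S : Finset (Fin M)) (h : Fin k → Fin M) :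
    (S ∪ positions h).card ≤ S.card + k :=
  (Finset.card_union_le _ _).trans (Nat.add_le_add_left (card_positions_le h) _)

lemma card_le_card_union_positions (S : Finset (Fin M)) (h : Fin k → Fin M) :
    S.card ≤ (S ∪ positions h).card :=
  Finset.card_le_card Finset.subset_union_left

lemma comp_mem_hashes (e : Equiv.Perm (Fin M)) {h : Fin k → Fin M} :
    e ∘ h ∈ hashes c M k ↔ h ∈ hashes c M k := by
  cases c
  · simp
  · simp [e.injective.of_comp_iff]

lemma positions_comp (e : Equiv.Perm (Fin M)) (h : Fin k → Fin M) :
    positions (e ∘ h) = (positions h).image e := by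
  simp [positions, Finset.image_image]

lemma card_step_comp (e : Equiv.Perm (Fin M)) (S : Finset (Fin M)) (h h' : Fin k → Fin M) :
    (step σ r (S.image e) (e ∘ h) (e ∘ h')).card = (step σ r S h h').card := by
  have hc : ∀ T : Finset (Fin M), (T.image e).card = T.card := fun T =>
    Finset.card_image_of_injective T e.injective
  unfold step
  rw [positions_comp, positions_comp, ← Finset.image_union, hc]
  split_ifs
  · exact hc _
  · cases r <;> simp [hc]

lemma exists_perm_image_eq {S T : Finset (Fin M)} (hST : S.card = T.card) :
    ∃ e : Equiv.Perm (Fin M), S.image e = T := by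
  refine ⟨(Finset.equivOfCardEq hST).extendSubtype, ?_⟩
  refine Finset.eq_of_subset_of_card_le (fun x hx => ?_) ?_
  · obtain ⟨y, hy, rfl⟩ := Finset.mem_image.1 hx
    exact Equiv.extendSubtype_mem (Finset.equivOfCardEq hST) y hy
  · rw [Finset.card_image_of_injective _ (Equiv.injective _), hST]

lemma moveProb_congr_card {S T : Finset (Fin M)} (hST : S.card = T.card) (j : ℕ) :
    moveProb c r σ k S j = moveProb c r σ k T j := by
  obtain ⟨e, rfl⟩ := exists_perm_image_eq hST
  unfold moveProb
  congr 2
  refine Finset.card_equiv ((Equiv.arrowCongr (Equiv.refl (Fin k)) e).prodCongr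
    (Equiv.arrowCongr (Equiv.refl (Fin k)) e)) fun p => ?_
  have h1 : (Equiv.arrowCongr (Equiv.refl (Fin k)) e) p.1 = e ∘ p.1 := rfl
  have h2 : (Equiv.arrowCongr (Equiv.refl (Fin k)) e) p.2 = e ∘ p.2 := rfl
  simp only [Finset.mem_filter, Finset.mem_product, Equiv.prodCongr_apply, Prod.map, h1, h2,
    comp_mem_hashes, card_step_comp]

lemma card_filter_lt {i : ℕ} (hi : i ≤ M) :
    (Finset.univ.filter fun x : Fin M => (x : ℕ) < i).card = i := by
  rw [Fin.card_filter_val_lt, min_eq_right hi]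

lemma moveProb_eq_tau {S : Finset (Fin M)} (j : ℕ) :
    moveProb c r σ k S j = tau c r M σ k S.card j :=
  moveProb_congr_card (card_filter_lt (card_finset_fin_le S)).symm j

/-- To establish a property of `tau`, it suffices to establish it for `moveProb` from every set of
the right size. -/
lemma tau_eq_moveProb {S : Finset (Fin M)} {i : ℕ} (hS : S.card = i) (j : ℕ) :
    tau c r M σ k i j = moveProb c r σ k S j := by
  rw [moveProb_eq_tau, hS]

lemma card_step_le (hkσ : k ≤ σ) (S : Finset (Fin M)) (h h' : Fin k → Fin M) :
    (step σ r S h h').card ≤ σ := by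
  unfold step
  split_ifs with hc
  · exact hc
  · cases r
    · simp
    · exact (card_positions_le h).trans hkσ
    · exact (card_positions_le h').trans hkσ

lemma card_product_hashes_pos (hkM : k ≤ M) :
    (0 : ℝ) < (hashes c M k ×ˢ hashes c M k).card := by
  exact_mod_cast ((hashes_nonempty hkM).product (hashes_nonempty hkM)).card_pos

lemma moveProb_nonneg (S : Finset (Fin M)) (j : ℕ) : 0 ≤ moveProb c r σ k S j := by
  unfold moveProb
  positivity

lemma sum_moveProb (hkσ : k ≤ σ) (hkM : k ≤ M) (S : Finset (Fin M)) :
    ∑ j ∈ Finset.range (σ + 1), moveProb c r σ k S j = 1 := by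
  unfold moveProb
  rw [← Finset.sum_div, div_eq_one_iff_eq (card_product_hashes_pos hkM).ne', ← Nat.cast_sum]
  congr 1
  exact (Finset.card_eq_sum_card_fiberwise fun p _ =>
    Finset.mem_coe.2 (Finset.mem_range.2 (Nat.lt_succ_of_le (card_step_le hkσ S p.1 p.2)))).symm

lemma moveProb_pos {S : Finset (Fin M)} {j : ℕ} {h h' : Fin k → Fin M} (hh : h ∈ hashes c M k)
    (hh' : h' ∈ hashes c M k) (hj : (step σ r S h h').card = j) : 0 < moveProb c r σ k S j := by
  unfold moveProb
  have hmem : (h, h') ∈ hashes c M k ×ˢ hashes c M k := Finset.mk_mem_product hh hh'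
  refine div_pos ?_ ?_ <;> norm_cast
  · exact Finset.card_pos.2 ⟨(h, h'), Finset.mem_filter.2 ⟨hmem, hj⟩⟩
  · exact Finset.card_pos.2 ⟨_, hmem⟩

lemma moveProb_eq_zero {S : Finset (Fin M)} {j : ℕ}
    (hj : ∀ h ∈ hashes c M k, ∀ h' ∈ hashes c M k, (step σ r S h h').card ≠ j) :
    moveProb c r σ k S j = 0 := by
  unfold moveProb
  rw [Finset.filter_eq_empty_iff.2 fun p hp => hj p.1 (Finset.mem_product.1 hp).1 p.2
    (Finset.mem_product.1 hp).2]
  simp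

end Hashes

/-! ### Probabilities of events that depend on one hash sequence -/

section HashProb

variable {c : Scheme} {r : Recycle} {M k σ : ℕ}

open Classical in
/-- The probability that a random sequence of `k` hash positions satisfies `Q`. -/
noncomputable def hashProb (c : Scheme) (M k : ℕ) (Q : (Fin k → Fin M) → Prop) : ℝ :=
  (((hashes c M k).filter Q).card : ℝ) / (hashes c M k).card

lemma hashProb_def (Q : (Fin k → Fin M) → Prop) [DecidablePred Q] :
    hashProb c M k Q = (((hashes c M k).filter Q).card : ℝ) / (hashes c M k).card := by
  unfold hashProb
  congr!

lemma hashProb_eq_one (hkM : k ≤ M) {Q : (Fin k → Fin M) → Prop}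
    (h : ∀ x ∈ hashes c M k, Q x) : hashProb c M k Q = 1 := by
  classical
  rw [hashProb_def, Finset.filter_true_of_mem h, div_self (card_hashes_pos hkM).ne']

lemma moveProb_eq_mul {S : Finset (Fin M)} {j : ℕ} {A B : (Fin k → Fin M) → Prop}
    (h : ∀ h ∈ hashes c M k, ∀ h' ∈ hashes c M k, ((step σ r S h h').card = j ↔ A h ∧ B h')) :
    moveProb c r σ k S j = hashProb c M k A * hashProb c M k B := by
  classical
  unfold moveProb hashProb
  rw [div_mul_div_comm, ← Nat.cast_mul, ← Nat.cast_mul, ← Finset.card_product,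
    ← Finset.card_product]
  congr 3
  ext p
  simp only [Finset.mem_filter, Finset.mem_product]
  constructor
  · rintro ⟨⟨h1, h2⟩, hj⟩
    have := (h _ h1 _ h2).1 hj
    exact ⟨⟨h1, this.1⟩, h2, this.2⟩
  · rintro ⟨⟨h1, hA⟩, h2, hB⟩
    exact ⟨⟨h1, h2⟩, (h _ h1 _ h2).2 ⟨hA, hB⟩⟩

lemma moveProb_eq_hashProb (hkM : k ≤ M) {S : Finset (Fin M)} {j : ℕ}
    {A : (Fin k → Fin M) → Prop}
    (h : ∀ h ∈ hashes c M k, ∀ h' ∈ hashes c M k, ((step σ r S h h').card = j ↔ A h)) :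
    moveProb c r σ k S j = hashProb c M k A := by
  rw [moveProb_eq_mul (A := A) (B := fun _ => True) (fun x hx y hy => by simp [h x hx y hy]),
    hashProb_eq_one hkM (Q := fun _ => True) (fun _ _ => trivial), mul_one]

/-- A move to `j` set bits that cannot come from a recycling. -/
lemma moveProb_eq_of_recycle_ne (hkM : k ≤ M) {S : Finset (Fin M)} {j : ℕ} (hj : j ≤ σ)
    (h : ∀ h ∈ hashes c M k, ∀ h' ∈ hashes c M k, σ < (S ∪ positions h).card →
      (step σ r S h h').card ≠ j) :
    moveProb c r σ k S j = hashProb c M k fun h => (S ∪ positions h).card = j := by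
  refine moveProb_eq_hashProb hkM fun x hx y hy => ?_
  by_cases hc : (S ∪ positions x).card ≤ σ
  · simp [step, hc]
  · have h1 := h x hx y hy (not_le.1 hc)
    exact iff_of_false h1 (by omega)

lemma card_step_forget_of_lt {S : Finset (Fin M)} {h h' : Fin k → Fin M}
    (hc : σ < (S ∪ positions h).card) : (step σ .forget S h h').card = 0 := by
  simp [step, not_le.2 hc]

lemma card_step_keep_of_lt {S : Finset (Fin M)} {h h' : Fin k → Fin M}
    (hc : σ < (S ∪ positions h).card) :
    (step σ .keep S h h').card = (positions h).card := by
  simp [step, not_le.2 hc]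

lemma card_step_rehash_of_lt {S : Finset (Fin M)} {h h' : Fin k → Fin M}
    (hc : σ < (S ∪ positions h).card) :
    (step σ .rehash S h h').card = (positions h').card := by
  simp [step, not_le.2 hc]

lemma card_step_of_le {S : Finset (Fin M)} {h h' : Fin k → Fin M}
    (hc : (S ∪ positions h).card ≤ σ) :
    (step σ r S h h').card = (S ∪ positions h).card := by
  simp [step, hc]

lemma card_step_le_of_lt {S : Finset (Fin M)} {h h' : Fin k → Fin M}
    (hc : σ < (S ∪ positions h).card) : (step σ r S h h').card ≤ k := by
  cases r
  · simp [card_step_forget_of_lt hc]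
  · simpa [card_step_keep_of_lt hc] using card_positions_le h
  · simpa [card_step_rehash_of_lt hc] using card_positions_le h'

lemma card_step_pos_of_lt (hr : r ≠ .forget) (hk : 1 ≤ k) {S : Finset (Fin M)}
    {h h' : Fin k → Fin M} (hc : σ < (S ∪ positions h).card) : 0 < (step σ r S h h').card := by
  cases r
  · exact absurd rfl hr
  · simpa [card_step_keep_of_lt hc] using card_positions_pos hk h
  · simpa [card_step_rehash_of_lt hc] using card_positions_pos hk h'

lemma moveProb_forget_of_pos (hkM : k ≤ M) {S : Finset (Fin M)} {j : ℕ} (hj : j ≤ σ)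
    (hj1 : 1 ≤ j) :
    moveProb c .forget σ k S j = hashProb c M k fun h => (S ∪ positions h).card = j :=
  moveProb_eq_of_recycle_ne hkM hj fun _ _ _ _ hc => by
    rw [card_step_forget_of_lt hc]
    omega

lemma moveProb_forget_zero (hkM : k ≤ M) {S : Finset (Fin M)} (hS : 1 ≤ S.card) :
    moveProb c .forget σ k S 0 = hashProb c M k fun h => σ < (S ∪ positions h).card := by
  refine moveProb_eq_hashProb hkM fun x _ y _ => ?_
  by_cases hc : (S ∪ positions x).card ≤ σ
  · rw [card_step_of_le hc]
    have := card_le_card_union_positions S x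
    omega
  · simp [card_step_forget_of_lt (not_le.1 hc), not_le.1 hc]

end HashProb

/-! ### Adding one more hash position -/

section Recursion

variable {c : Scheme} {r : Recycle} {M k σ : ℕ}

/-- The number of positions that are excluded for the next hash after `k` hashes. -/
def excluded : Scheme → ℕ → ℕ
  | .colliding, _ => 0
  | .nonColliding, k => k

/-- The possible values of one further hash after the hash positions `h`. -/
def allowed (c : Scheme) (h : Fin k → Fin M) : Finset (Fin M) :=
  match c with
  | .colliding => Finset.univ
  | .nonColliding => (positions h)ᶜ

lemma positions_cons (x : Fin M) (h : Fin k → Fin M) :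
    positions (Fin.cons x h : Fin (k + 1) → Fin M) = insert x (positions h) := by
  ext y
  simp [positions, Fin.exists_fin_succ, eq_comm]

lemma cons_mem_hashes {x : Fin M} {h : Fin k → Fin M} :
    (Fin.cons x h : Fin (k + 1) → Fin M) ∈ hashes c M (k + 1) ↔
      h ∈ hashes c M k ∧ x ∈ allowed c h := by
  cases c
  · simp [allowed]
  · simp [allowed, positions, Fin.cons_injective_iff, and_comm]

lemma excluded_le : excluded c k ≤ k := by
  cases c <;> simp [excluded]

lemma card_allowed {h : Fin k → Fin M} (hh : h ∈ hashes c M k) :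
    (allowed c h).card = M - excluded c k := by
  cases c
  · simp [allowed, excluded]
  · simp [allowed, excluded, Finset.card_compl, card_positions_of_mem_nonColliding hh]

open Classical in
lemma card_filter_hashes_succ (Q : (Fin (k + 1) → Fin M) → Prop) :
    ((hashes c M (k + 1)).filter Q).card =
      ∑ h ∈ hashes c M k, ((allowed c h).filter fun x => Q (Fin.cons x h)).card := by
  rw [← Finset.card_sigma]
  refine (Finset.card_nbij' (fun p => (Fin.cons p.2 p.1 : Fin (k + 1) → Fin M))
    (fun f => ⟨Fin.tail f, f 0⟩) ?_ ?_ ?_ ?_).symm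
  · rintro ⟨h, x⟩ hp
    simp only [Finset.coe_sigma, Set.mem_sigma_iff, Finset.mem_coe, Finset.mem_filter] at hp
    simp only [Finset.mem_coe, Finset.mem_filter, cons_mem_hashes]
    exact ⟨⟨hp.1, hp.2.1⟩, hp.2.2⟩
  · intro f hf
    simp only [Finset.mem_coe, Finset.mem_filter] at hf
    rw [← Fin.cons_self_tail f, cons_mem_hashes] at hf
    simp only [Finset.coe_sigma, Set.mem_sigma_iff, Finset.mem_coe, Finset.mem_filter]
    exact ⟨hf.1.1, hf.1.2, hf.2⟩
  · rintro ⟨h, x⟩ _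
    simp
  · intro f _
    simp

lemma card_hashes_succ :
    (hashes c M (k + 1)).card = (hashes c M k).card * (M - excluded c k) := by
  classical
  have h := card_filter_hashes_succ (c := c) (M := M) (k := k) fun _ => True
  simp only [Finset.filter_true] at h
  rw [h, Finset.sum_congr rfl fun x hx => card_allowed hx, Finset.sum_const, smul_eq_mul]

open Classical in
/-- One-step conditioning on the first `k` of `k + 1` hashes, for an event that has `a` favourable
values of the last hash if `A` holds and `b` further ones if `B` holds. -/
lemma hashProb_succ (hkM : k < M) {Q : (Fin (k + 1) → Fin M) → Prop}
    {A B : (Fin k → Fin M) → Prop} {a b : ℝ}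
    (h : ∀ h ∈ hashes c M k, (((allowed c h).filter fun x => Q (Fin.cons x h)).card : ℝ) =
      (if A h then a else 0) + if B h then b else 0) :
    hashProb c M (k + 1) Q = hashProb c M k A * (a / ((M : ℝ) - excluded c k)) +
      hashProb c M k B * (b / ((M : ℝ) - excluded c k)) := by
  have hle : excluded c k ≤ M := excluded_le.trans hkM.le
  unfold hashProb
  rw [card_filter_hashes_succ, card_hashes_succ]
  push_cast [Nat.cast_sub hle]
  rw [Finset.sum_congr rfl h, Finset.sum_add_distrib, ← Finset.sum_filter, ← Finset.sum_filter,
    Finset.sum_const, Finset.sum_const, nsmul_eq_mul, nsmul_eq_mul, add_div, mul_div_mul_comm,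
    mul_div_mul_comm]

lemma card_filter_allowed_mem {S : Finset (Fin M)} {h : Fin k → Fin M}
    (hh : h ∈ hashes c M k) :
    (((allowed c h).filter fun x => x ∈ S ∪ positions h).card : ℝ) =
      ((S ∪ positions h).card : ℝ) - excluded c k := by
  cases c
  · have : ((allowed .colliding h).filter fun x => x ∈ S ∪ positions h) = S ∪ positions h := by
      ext x
      simp [allowed]
    rw [this]
    simp [excluded]
  · have hsub : positions h ⊆ S ∪ positions h := Finset.subset_union_right
    have : ((allowed .nonColliding h).filter fun x => x ∈ S ∪ positions h) =
        (S ∪ positions h) \ positions h := by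
      ext x
      simp only [allowed, Finset.mem_filter, Finset.mem_compl, Finset.mem_sdiff]
      exact and_comm
    rw [this, Finset.card_sdiff_of_subset hsub, Nat.cast_sub (Finset.card_le_card hsub),
      card_positions_of_mem_nonColliding hh]
    rfl

lemma card_filter_allowed_notMem {S : Finset (Fin M)} {h : Fin k → Fin M} :
    (((allowed c h).filter fun x => x ∉ S ∪ positions h).card : ℝ) =
      (M : ℝ) - (S ∪ positions h).card := by
  have : ((allowed c h).filter fun x => x ∉ S ∪ positions h) = (S ∪ positions h)ᶜ := by
    ext x
    cases c <;> simp +contextual [allowed]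
  rw [this, Finset.card_compl, Fintype.card_fin, Nat.cast_sub (card_finset_fin_le _)]

lemma hashProb_card_succ (hkM : k < M) (S : Finset (Fin M)) {j : ℕ} (hj : 1 ≤ j) :
    (hashProb c M (k + 1) fun h => (S ∪ positions h).card = j) =
      (hashProb c M k fun h => (S ∪ positions h).card = j) *
        (((j : ℝ) - excluded c k) / ((M : ℝ) - excluded c k)) +
      (hashProb c M k fun h => (S ∪ positions h).card = j - 1) *
        (((M : ℝ) - j + 1) / ((M : ℝ) - excluded c k)) := by
  classical
  refine hashProb_succ hkM fun h hh => ?_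
  simp only [positions_cons, Finset.union_insert, Finset.card_insert_eq_ite]
  by_cases h1 : (S ∪ positions h).card = j
  · rw [if_pos h1, if_neg (by omega), add_zero, ← h1, ← card_filter_allowed_mem hh]
    congr 2
    refine Finset.filter_congr fun x _ => ?_
    split_ifs with hx <;> simp [hx]
  · rw [if_neg h1, zero_add]
    split_ifs with h2
    · rw [show (M : ℝ) - j + 1 = (M : ℝ) - (S ∪ positions h).card by
        rw [h2, Nat.cast_sub hj]; push_cast; ring, ← card_filter_allowed_notMem (c := c)]
      congr 2
      refine Finset.filter_congr fun x _ => ?_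
      split_ifs with hx
      · simp [hx, h1]
      · simp only [hx, not_false_eq_true, iff_true]
        omega
    · rw [Finset.filter_false_of_mem, Finset.card_empty, Nat.cast_zero]
      intro x _
      split_ifs <;> omega

lemma hashProb_lt_card_succ (hkM : k < M) (S : Finset (Fin M)) :
    (hashProb c M (k + 1) fun h => σ < (S ∪ positions h).card) =
      (hashProb c M k fun h => σ < (S ∪ positions h).card) +
      (hashProb c M k fun h => (S ∪ positions h).card = σ) *
        (((M : ℝ) - σ) / ((M : ℝ) - excluded c k)) := by
  classical
  have hlt : excluded c k < M := excluded_le.trans_lt hkM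
  have hpos : (0 : ℝ) < (M : ℝ) - excluded c k := sub_pos.2 (by exact_mod_cast hlt)
  rw [hashProb_succ hkM (A := fun h => σ < (S ∪ positions h).card)
    (B := fun h => (S ∪ positions h).card = σ) (a := (M : ℝ) - excluded c k) (b := (M : ℝ) - σ),
    div_self hpos.ne', mul_one]
  intro h hh
  simp only [positions_cons, Finset.union_insert, Finset.card_insert_eq_ite]
  by_cases h1 : σ < (S ∪ positions h).card
  · rw [if_pos h1, if_neg (by omega), add_zero, Finset.filter_true_of_mem, card_allowed hh,
      Nat.cast_sub hlt.le]
    intro x _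
    split_ifs <;> omega
  · rw [if_neg h1, zero_add]
    split_ifs with h2
    · rw [← h2, ← card_filter_allowed_notMem (c := c)]
      congr 2
      refine Finset.filter_congr fun x _ => ?_
      split_ifs with hx <;> simp [hx]
    · rw [Finset.filter_false_of_mem, Finset.card_empty, Nat.cast_zero]
      intro x _
      split_ifs <;> omega

end Recursion

/-! ### The set of hash positions, given its size -/

section Image

variable {c : Scheme} {r : Recycle} {M k σ : ℕ}

lemma card_filter_positions_eq {T U : Finset (Fin M)} (hTU : T.card = U.card) :
    (Finset.univ.filter fun h : Fin k → Fin M => positions h = T).card =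
      (Finset.univ.filter fun h : Fin k → Fin M => positions h = U).card := by
  obtain ⟨e, rfl⟩ := exists_perm_image_eq hTU
  refine Finset.card_equiv (Equiv.arrowCongr (Equiv.refl (Fin k)) e) fun h => ?_
  have h1 : (Equiv.arrowCongr (Equiv.refl (Fin k)) e) h = e ∘ h := rfl
  simp only [Finset.mem_filter, Finset.mem_univ, true_and, h1, positions_comp]
  exact (Finset.image_injective e.injective).eq_iff.symm

/-- Each set of `j` positions is the set of hash positions of the same number of hash sequences of
length `k`, namely of the number of surjections from `k` hashes onto `j` positions. -/
lemma card_filter_card_positions {j : ℕ} (hj : j ≤ M) (Q : Finset (Fin M) → Prop)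
    [DecidablePred Q] :
    (Finset.univ.filter fun h : Fin k → Fin M => (positions h).card = j ∧ Q (positions h)).card =
      ((Finset.univ : Finset (Fin M)).powersetCard j |>.filter Q).card *
      (Finset.univ.filter fun h : Fin k → Fin M =>
        positions h = Finset.univ.filter fun x : Fin M => (x : ℕ) < j).card := by
  rw [Finset.card_eq_sum_card_fiberwise (f := positions)
    (t := (Finset.univ : Finset (Fin M)).powersetCard j |>.filter Q)]
  · rw [← smul_eq_mul, ← Finset.sum_const]
    refine Finset.sum_congr rfl fun T hT => ?_
    simp only [Finset.mem_filter, Finset.mem_powersetCard_univ] at hT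
    rw [← card_filter_positions_eq (k := k) (hT.1.trans (card_filter_lt hj).symm),
      Finset.filter_filter]
    congr 1
    refine Finset.filter_congr fun h _ => ?_
    constructor
    · exact fun h => h.2
    · rintro rfl
      exact ⟨hT, rfl⟩
  · intro h hh
    simpa using hh

lemma hashes_nonColliding_eq :
    hashes .nonColliding M k = Finset.univ.filter fun h => (positions h).card = k := by
  ext h
  simp [injective_iff_card_positions]

lemma hashProb_nonColliding (hkM : k ≤ M) (Q : Finset (Fin M) → Prop) [DecidablePred Q] :
    (hashProb .nonColliding M k fun h => Q (positions h)) =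
      (((Finset.univ : Finset (Fin M)).powersetCard k |>.filter Q).card : ℝ) / M.choose k := by
  have h1 := card_filter_card_positions (k := k) hkM Q
  have h2 := card_filter_card_positions (k := k) hkM fun _ => True
  simp only [and_true, Finset.filter_true, Finset.card_powersetCard, Finset.card_univ,
    Fintype.card_fin] at h2
  have hpos := card_hashes_pos (c := .nonColliding) hkM
  rw [hashes_nonColliding_eq, h2, Nat.cast_mul] at hpos
  rw [hashProb_def, hashes_nonColliding_eq, Finset.filter_filter, h1, h2]
  push_cast
  exact mul_div_mul_right _ _ fun h0 => hpos.ne' (by rw [h0, mul_zero])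

/-- Given that colliding hashes occupy `j` positions, these form a uniformly random set of `j`
positions, as do `j` non-colliding hashes. -/
lemma hashProb_colliding_and {j : ℕ} (hj : j ≤ M) (Q : Finset (Fin M) → Prop) :
    (hashProb .colliding M k fun h => (positions h).card = j ∧ Q (positions h)) =
      (hashProb .nonColliding M j fun h => Q (positions h)) *
        hashProb .colliding M k fun h => (positions h).card = j := by
  classical
  have h1 := card_filter_card_positions (k := k) hj Q
  have h2 := card_filter_card_positions (k := k) hj fun _ => True
  simp only [and_true, Finset.filter_true, Finset.card_powersetCard, Finset.card_univ,
    Fintype.card_fin] at h2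
  have hchoose : (M.choose j : ℝ) ≠ 0 := by exact_mod_cast (Nat.choose_pos hj).ne'
  rw [hashProb_nonColliding hj]
  have huniv : hashes .colliding M k = Finset.univ := by simp [hashes]
  rw [hashProb_def, hashProb_def, huniv, h1, h2]
  push_cast
  field_simp

lemma hashProb_positions_subset (hkM : k ≤ M) (S : Finset (Fin M)) :
    (hashProb c M k fun h => positions h ⊆ S) = rho c M k S.card := by
  classical
  cases c
  · have huniv : hashes .colliding M k = Finset.univ := by simp [hashes]
    have hpi : (Finset.univ.filter fun h : Fin k → Fin M => positions h ⊆ S) =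
        Fintype.piFinset fun _ => S := by
      ext h
      simp [positions, Finset.image_subset_iff]
    rw [hashProb_def, huniv, hpi]
    simp [rho, div_pow]
  · rw [hashProb_nonColliding hkM (· ⊆ S)]
    have : ((Finset.univ : Finset (Fin M)).powersetCard k |>.filter (· ⊆ S)) =
        S.powersetCard k := by
      ext T
      simp [Finset.mem_powersetCard, and_comm]
    rw [this, Finset.card_powersetCard]
    rfl

/-- A set `S` of at most `σ` bits can always move, without a recycling, to
`min σ (max (|S| + 1) k)` bits. Repeating this leads to `σ` bits and stays there. -/
lemma moveProb_min_max_pos (hkσ : k ≤ σ) (hσM : σ ≤ M) (hk : 1 ≤ k) {S : Finset (Fin M)}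
    (hS : S.card ≤ σ) : 0 < moveProb c r σ k S (min σ (max (S.card + 1) k)) := by
  set m := min σ (max (S.card + 1) k) with hm
  obtain ⟨U, hSU, -, hU⟩ := Finset.exists_subsuperset_card_eq (Finset.subset_univ S)
    (n := m) (by omega) (by rw [Finset.card_univ, Fintype.card_fin]; omega)
  have hdiff : (U \ S).card ≤ k := by
    rw [Finset.card_sdiff_of_subset hSU]
    omega
  -- Hashing to a set `T` of `k` positions with `U \ S ⊆ T ⊆ U` moves the filter from `S` to `U`.
  obtain ⟨T, hT1, hT2, hT⟩ := Finset.exists_subsuperset_card_eq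
    (Finset.sdiff_subset : U \ S ⊆ U) hdiff (by omega)
  have hpos : positions (fun x => (T.orderEmbOfFin hT) x) = T := by
    rw [positions, ← Finset.coe_inj]
    simp
  have hunion : S ∪ T = U := by
    refine Finset.Subset.antisymm (Finset.union_subset hSU hT2) fun x hx => ?_
    by_cases hxS : x ∈ S
    · exact Finset.mem_union_left _ hxS
    · exact Finset.mem_union_right _ (hT1 (Finset.mem_sdiff.2 ⟨hx, hxS⟩))
  have hmem : (fun x => (T.orderEmbOfFin hT) x) ∈ hashes c M k :=
    mem_hashes_of_injective (T.orderEmbOfFin hT).injective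
  refine moveProb_pos hmem hmem ?_
  rw [card_step_of_le] <;> rw [hpos, hunion, hU]
  omega

end Image


/-! ### The transition probabilities -/

section Transitions

variable {c : Scheme} {r : Recycle} {M k σ i j : ℕ}

lemma exists_card_eq (hi : i ≤ M) : ∃ S : Finset (Fin M), S.card = i :=
  ⟨_, card_filter_lt hi⟩

lemma tau_zero_hashes (hσM : σ ≤ M) (hi : i ≤ σ) :
    tau c r M σ 0 i j = if i = j then 1 else 0 := by
  obtain ⟨S, rfl⟩ := exists_card_eq (hi.trans hσM)
  rw [tau_eq_moveProb rfl]
  have hstep : ∀ h h' : Fin 0 → Fin M, (step σ r S h h').card = S.card := by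
    intro h h'
    have h0 : S ∪ positions h = S := by simp [positions]
    rw [card_step_of_le] <;> simp [h0, hi]
  split_ifs with hj
  · rw [moveProb_eq_hashProb (Nat.zero_le M) (A := fun _ => True) fun h _ h' _ => by
      simp [hstep, hj], hashProb_eq_one (Nat.zero_le M) fun _ _ => trivial]
  · exact moveProb_eq_zero fun h _ h' _ => by rwa [hstep]

lemma tau_zero_zero (hk : 1 ≤ k) (hkσ : k ≤ σ) : tau c r M σ k 0 0 = 0 := by
  rw [tau_eq_moveProb (S := ∅) Finset.card_empty]
  refine moveProb_eq_zero fun h _ h' _ => ?_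
  have hle := card_union_positions_le ∅ h
  rw [card_step_of_le (by simpa using hle.trans (by simpa using hkσ)), Finset.empty_union]
  exact (card_positions_pos hk h).ne'

lemma tau_eq_zero_of_add_lt (hσM : σ ≤ M) (hi : i ≤ σ) (hij : i + k < j) :
    tau c r M σ k i j = 0 := by
  obtain ⟨S, rfl⟩ := exists_card_eq (hi.trans hσM)
  rw [tau_eq_moveProb rfl]
  refine moveProb_eq_zero fun h _ h' _ => ?_
  by_cases hc : (S ∪ positions h).card ≤ σ
  · rw [card_step_of_le hc]
    have := card_union_positions_le S h
    omega
  · have := card_step_le_of_lt (r := r) (h' := h') (not_le.1 hc)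
    omega

/-- Circumstances under which a move to `j` set bits cannot come from a recycling. -/
lemma moveProb_eq_hashProb_card (hkM : k ≤ M) {S : Finset (Fin M)} (hj : j ≤ σ)
    (h : (r = .forget ∧ (1 ≤ j ∨ S.card + k ≤ σ)) ∨ (2 * k ≤ σ ∧ S.card ≤ j) ∨
      (2 * k + 1 ≤ σ ∧ S.card ≤ j + 1)) :
    moveProb c r σ k S j = hashProb c M k fun h => (S ∪ positions h).card = j := by
  refine moveProb_eq_of_recycle_ne hkM hj fun x _ y _ hc => ?_
  have h1 := card_union_positions_le S x
  rcases h with ⟨rfl, h⟩ | h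
  · rw [card_step_forget_of_lt hc]
    omega
  · have := card_step_le_of_lt (r := r) (h' := y) hc
    omega

lemma tau_forward (hkσ : k + 1 ≤ σ) (hσM : σ < M) (hr : r = .forget ∨ 2 * (k + 1) ≤ σ)
    (hi : i ≤ σ) (hj : j ≤ σ) (hij : i ≤ j) (hj1 : 1 ≤ j) :
    tau c r M σ (k + 1) i j =
      tau c r M σ k i j * (((j : ℝ) - excluded c k) / ((M : ℝ) - excluded c k)) +
      tau c r M σ k i (j - 1) * (((M : ℝ) - j + 1) / ((M : ℝ) - excluded c k)) := by
  obtain ⟨S, rfl⟩ := exists_card_eq (hi.trans hσM.le)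
  rw [tau_eq_moveProb rfl, tau_eq_moveProb rfl, tau_eq_moveProb rfl,
    moveProb_eq_hashProb_card (by omega) hj, moveProb_eq_hashProb_card (by omega) hj,
    moveProb_eq_hashProb_card (by omega) (by omega : j - 1 ≤ σ),
    hashProb_card_succ (by omega) S hj1]
  · rcases hr with hr | hr
    · exact Or.inl ⟨hr, by omega⟩
    · exact Or.inr (by omega)
  · rcases hr with hr | hr
    · exact Or.inl ⟨hr, by omega⟩
    · exact Or.inr (by omega)
  · rcases hr with hr | hr
    · exact Or.inl ⟨hr, by omega⟩
    · exact Or.inr (by omega)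

lemma tau_forget_zero_succ (hkσ : k + 1 ≤ σ) (hσM : σ < M) (hi : i ≤ σ) (hi1 : 1 ≤ i) :
    tau c .forget M σ (k + 1) i 0 = tau c .forget M σ k i 0 +
      tau c .forget M σ k i σ * (((M : ℝ) - σ) / ((M : ℝ) - excluded c k)) := by
  obtain ⟨S, rfl⟩ := exists_card_eq (hi.trans hσM.le)
  rw [tau_eq_moveProb rfl, tau_eq_moveProb rfl, tau_eq_moveProb rfl,
    moveProb_forget_zero (by omega) hi1, moveProb_forget_zero (by omega) hi1,
    moveProb_forget_of_pos (by omega) le_rfl (by omega), hashProb_lt_card_succ (by omega)]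

lemma tau_nonColliding_zero_self (hkσ : k ≤ σ) (hσM : σ ≤ M) :
    tau .nonColliding r M σ k 0 k = 1 := by
  rw [tau_eq_moveProb (S := ∅) Finset.card_empty,
    moveProb_eq_hashProb (hkσ.trans hσM) (A := fun _ => True),
    hashProb_eq_one (hkσ.trans hσM) fun _ _ => trivial]
  intro h hh h' _
  have hcard := card_positions_of_mem_nonColliding hh
  rw [card_step_of_le (by simp [hcard, hkσ])]
  simp [hcard]

lemma tau_forget_eq_zero (hσM : σ ≤ M) (hi : i ≤ σ) (hj1 : 1 ≤ j) (hji : j < i) :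
    tau c .forget M σ k i j = 0 := by
  obtain ⟨S, rfl⟩ := exists_card_eq (hi.trans hσM)
  rw [tau_eq_moveProb rfl]
  refine moveProb_eq_zero fun h _ h' _ => ?_
  by_cases hc : (S ∪ positions h).card ≤ σ
  · rw [card_step_of_le hc]
    have := card_le_card_union_positions S h
    omega
  · rw [card_step_forget_of_lt (not_le.1 hc)]
    omega

lemma tau_zero_eq_hashProb (hkσ : k ≤ σ) (hσM : σ ≤ M) :
    tau c r M σ k 0 j = hashProb c M k fun h => (positions h).card = j := by
  rw [tau_eq_moveProb (S := ∅) Finset.card_empty]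
  refine moveProb_eq_hashProb (hkσ.trans hσM) fun h _ h' _ => ?_
  rw [card_step_of_le (by simpa using (card_positions_le h).trans hkσ), Finset.empty_union]

lemma tau_rehash_eq_mul (hkσ : k ≤ σ) (hσM : σ ≤ M) (hi : i ≤ σ) (hji : j < i) :
    tau c .rehash M σ k i j = tau c .forget M σ k i 0 * tau c .forget M σ k 0 j := by
  obtain ⟨S, rfl⟩ := exists_card_eq (hi.trans hσM)
  rw [tau_zero_eq_hashProb hkσ hσM, tau_eq_moveProb rfl, tau_eq_moveProb rfl,
    moveProb_forget_zero (hkσ.trans hσM) (by omega)]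
  refine moveProb_eq_mul fun h _ h' _ => ?_
  by_cases hc : (S ∪ positions h).card ≤ σ
  · rw [card_step_of_le hc]
    have := card_le_card_union_positions S h
    omega
  · simp [card_step_rehash_of_lt (not_le.1 hc), not_le.1 hc]

lemma tau_keep_eq_mul (hkσ : k ≤ σ) (hσM : σ ≤ M) (hi : i ≤ σ) (hjk : j ≤ k) (hji : j < i) :
    tau .colliding .keep M σ k i j =
      tau .nonColliding .forget M σ j i 0 * tau .colliding .forget M σ k 0 j := by
  obtain ⟨S, rfl⟩ := exists_card_eq (hi.trans hσM)
  rw [tau_zero_eq_hashProb hkσ hσM, tau_eq_moveProb rfl, tau_eq_moveProb rfl,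
    moveProb_forget_zero (by omega) (by omega),
    ← hashProb_colliding_and (by omega) fun T => σ < (S ∪ T).card]
  refine moveProb_eq_hashProb (hkσ.trans hσM) fun h _ h' _ => ?_
  by_cases hc : (S ∪ positions h).card ≤ σ
  · rw [card_step_of_le hc]
    have := card_le_card_union_positions S h
    omega
  · simp [card_step_keep_of_lt (not_le.1 hc), not_le.1 hc]

lemma card_step_nonColliding_of_lt (hr : r ≠ .forget) {S : Finset (Fin M)}
    {h h' : Fin k → Fin M} (hh : h ∈ hashes .nonColliding M k)
    (hh' : h' ∈ hashes .nonColliding M k) (hc : σ < (S ∪ positions h).card) :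
    (step σ r S h h').card = k := by
  cases r
  · exact absurd rfl hr
  · rw [card_step_keep_of_lt hc, card_positions_of_mem_nonColliding hh]
  · rw [card_step_rehash_of_lt hc, card_positions_of_mem_nonColliding hh']

lemma tau_nonColliding_retain_self (hr : r ≠ .forget) (hσM : σ ≤ M) (hi : i ≤ σ) (hki : k < i) :
    tau .nonColliding r M σ k i k = tau .nonColliding .forget M σ k i 0 := by
  obtain ⟨S, rfl⟩ := exists_card_eq (hi.trans hσM)
  rw [tau_eq_moveProb rfl, tau_eq_moveProb rfl, moveProb_forget_zero (by omega) (by omega)]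
  refine moveProb_eq_hashProb (by omega) fun h hh h' hh' => ?_
  by_cases hc : (S ∪ positions h).card ≤ σ
  · rw [card_step_of_le hc]
    have := card_le_card_union_positions S h
    omega
  · simp [card_step_nonColliding_of_lt hr hh hh' (not_le.1 hc), not_le.1 hc]

lemma tau_nonColliding_retain_eq_zero (hr : r ≠ .forget) (hσM : σ ≤ M) (hi : i ≤ σ) (hki : k < i)
    (hjk : j < k) : tau .nonColliding r M σ k i j = 0 := by
  obtain ⟨S, rfl⟩ := exists_card_eq (hi.trans hσM)
  rw [tau_eq_moveProb rfl]
  refine moveProb_eq_zero fun h hh h' hh' => ?_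
  by_cases hc : (S ∪ positions h).card ≤ σ
  · rw [card_step_of_le hc]
    have := card_le_card_union_positions S h
    omega
  · rw [card_step_nonColliding_of_lt hr hh hh' (not_le.1 hc)]
    omega

lemma tau_retain_zero (hr : r ≠ .forget) (hk : 1 ≤ k) (hσM : σ ≤ M) (hi : i ≤ σ) :
    tau c r M σ k i 0 = 0 := by
  obtain ⟨S, rfl⟩ := exists_card_eq (hi.trans hσM)
  rw [tau_eq_moveProb rfl]
  refine moveProb_eq_zero fun h _ h' _ => ?_
  by_cases hc : (S ∪ positions h).card ≤ σ
  · rw [card_step_of_le hc]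
    have h1 := Finset.card_le_card (Finset.subset_union_right (s₁ := S) (s₂ := positions h))
    have h2 := card_positions_pos hk h
    omega
  · exact (card_step_pos_of_lt hr hk (not_le.1 hc)).ne'

lemma tau_eq_zero_of_lt_of_lt (hσM : σ ≤ M) (hi : i ≤ σ) (hkj : k < j) (hji : j < i) :
    tau c r M σ k i j = 0 := by
  obtain ⟨S, rfl⟩ := exists_card_eq (hi.trans hσM)
  rw [tau_eq_moveProb rfl]
  refine moveProb_eq_zero fun h _ h' _ => ?_
  by_cases hc : (S ∪ positions h).card ≤ σ
  · rw [card_step_of_le hc]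
    have := card_le_card_union_positions S h
    omega
  · have := card_step_le_of_lt (r := r) (h' := h') (not_le.1 hc)
    omega

lemma tau_eq_zero_of_add_le (hσM : σ ≤ M) (hik : i + k ≤ σ) (hji : j < i) :
    tau c r M σ k i j = 0 := by
  obtain ⟨S, rfl⟩ := exists_card_eq (show i ≤ M by omega)
  rw [tau_eq_moveProb rfl]
  refine moveProb_eq_zero fun h _ h' _ => ?_
  have h1 := card_union_positions_le S h
  have h2 := card_le_card_union_positions S h
  rw [card_step_of_le (by omega)]
  omega

/-- The transition matrix of the number of set bits. -/
noncomputable def transition (c : Scheme) (r : Recycle) (M σ k : ℕ) :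
    Matrix (Fin (σ + 1)) (Fin (σ + 1)) ℝ :=
  fun i j => tau c r M σ k i j

lemma transition_mem_rowStochastic (hkσ : k ≤ σ) (hσM : σ ≤ M) :
    transition c r M σ k ∈ Matrix.rowStochastic ℝ (Fin (σ + 1)) := by
  rw [Matrix.mem_rowStochastic_iff_sum]
  refine ⟨fun i j => moveProb_nonneg _ _, fun i => ?_⟩
  have h := sum_moveProb (c := c) (r := r) hkσ (hkσ.trans hσM)
    (Finset.univ.filter fun x : Fin M => (x : ℕ) < i)
  rw [Finset.sum_range] at h
  exact h

lemma transition_pow_pos (hk : 1 ≤ k) (hkσ : k ≤ σ) (hσM : σ ≤ M) (i : Fin (σ + 1)) :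
    0 < (transition c r M σ k ^ σ) i (Fin.last σ) := by
  set next : Fin (σ + 1) → Fin (σ + 1) := fun i => ⟨min σ (max (i + 1) k), by omega⟩ with hnext
  have hpos : ∀ i, 0 < transition c r M σ k i (next i) := by
    intro i
    have hi : (i : ℕ) ≤ σ := Nat.le_of_lt_succ i.2
    have hcard := card_filter_lt (hi.trans hσM)
    have h := moveProb_min_max_pos (c := c) (r := r) hkσ hσM hk (hcard.trans_le hi)
    rw [hcard] at h
    exact h
  have hiter : ∀ m, min σ (i + m) ≤ (next^[m] i : ℕ) := by
    intro m
    induction m with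
    | zero => simp
    | succ m ih =>
      rw [Function.iterate_succ_apply']
      simp only [hnext] at ih ⊢
      omega
  have hlast : next^[σ] i = Fin.last σ := by
    have h1 := hiter σ
    have h2 := (next^[σ] i).2
    ext
    rw [Fin.val_last]
    omega
  rw [← hlast]
  exact pow_apply_iterate_pos (transition_mem_rowStochastic hkσ hσM) hpos σ i

lemma isStationary_iff {w : Fin (σ + 1) → ℝ} :
    IsStationary (tau c r M σ k) w ↔
      (∀ i, 0 ≤ w i) ∧ ∑ i, w i = 1 ∧ Matrix.vecMul w (transition c r M σ k) = w := by
  rw [IsStationary, funext_iff]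
  rfl

end Transitions


/-! ### Averages over the hashes of one message -/

section Average

variable {c : Scheme} {r : Recycle} {M k σ : ℕ}

/-- The average of `f` over the hashes of one message and its possible rehashes. -/
noncomputable def hashAvg (c : Scheme) (f : (Fin k → Fin M) × (Fin k → Fin M) → ℝ) : ℝ :=
  (∑ y ∈ hashes c M k ×ˢ hashes c M k, f y) / (hashes c M k ×ˢ hashes c M k).card

lemma hashAvg_step_card_eq (S : Finset (Fin M)) (j : ℕ) :
    hashAvg c (fun y : (Fin k → Fin M) × (Fin k → Fin M) =>
      if (step σ r S y.1 y.2).card = j then (1 : ℝ) else 0) =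
      moveProb c r σ k S j := by
  rw [hashAvg, Finset.sum_boole, moveProb]

lemma hashAvg_boole_fst (Q : (Fin k → Fin M) → Prop) [DecidablePred Q] :
    hashAvg c (fun y : (Fin k → Fin M) × (Fin k → Fin M) => if Q y.1 then (1 : ℝ) else 0) =
      hashProb c M k Q := by
  have hprod : ((hashes c M k ×ˢ hashes c M k).filter fun y => Q y.1) =
      (hashes c M k).filter Q ×ˢ hashes c M k := by
    ext y
    simp only [Finset.mem_filter, Finset.mem_product]
    tauto
  rw [hashAvg, Finset.sum_boole, hprod, Finset.card_product, Finset.card_product, Nat.cast_mul,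
    Nat.cast_mul, hashProb_def]
  rcases eq_or_ne ((hashes c M k).card : ℝ) 0 with h0 | h0
  · simp [h0]
  · exact mul_div_mul_right _ _ h0

lemma hashAvg_step_card (hkσ : k ≤ σ) (S : Finset (Fin M)) (f : ℕ → ℝ) :
    hashAvg c (fun y : (Fin k → Fin M) × (Fin k → Fin M) => f (step σ r S y.1 y.2).card) =
      ∑ j : Fin (σ + 1), moveProb c r σ k S j * f j := by
  rw [← Finset.sum_range fun j => moveProb c r σ k S j * f j]
  have h : ∀ y ∈ hashes c M k ×ˢ hashes c M k,
      (step σ r S y.1 y.2).card ∈ Finset.range (σ + 1) := fun y _ =>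
    Finset.mem_range.2 (Nat.lt_succ_of_le (card_step_le hkσ S y.1 y.2))
  rw [hashAvg, ← Finset.sum_fiberwise_of_maps_to h, Finset.sum_div]
  refine Finset.sum_congr rfl fun j _ => ?_
  rw [Finset.sum_congr rfl fun y hy => by rw [(Finset.mem_filter.1 hy).2], Finset.sum_const,
    nsmul_eq_mul, moveProb, div_mul_eq_mul_div]

lemma hashAvg_add (f g : (Fin k → Fin M) × (Fin k → Fin M) → ℝ) :
    hashAvg c (fun y => f y + g y) = hashAvg c f + hashAvg c g := by
  rw [hashAvg, Finset.sum_add_distrib, add_div]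
  rfl

lemma hashAvg_const_mul (a : ℝ) (f : (Fin k → Fin M) × (Fin k → Fin M) → ℝ) :
    hashAvg c (fun y => a * f y) = a * hashAvg c f := by
  rw [hashAvg, ← Finset.mul_sum, mul_div_assoc]
  rfl

lemma hashAvg_const (hkM : k ≤ M) (a : ℝ) :
    hashAvg c (fun _ : (Fin k → Fin M) × (Fin k → Fin M) => a) = a := by
  rw [hashAvg, Finset.sum_const, nsmul_eq_mul,
    mul_div_cancel_left₀ _ (card_product_hashes_pos hkM).ne']

end Average

/-! ### The past of the filter -/

section History

variable {Ω : Type*} {r : Recycle} {M k σ : ℕ} {H : ℕ → Fin 2 → Ω → Fin k → Fin M} {t : ℕ}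

/-- All hash positions of the messages before the message `t`. -/
def past (H : ℕ → Fin 2 → Ω → Fin k → Fin M) (t : ℕ) (ω : Ω) :
    (Finset.range t ×ˢ (Finset.univ : Finset (Fin 2)) : Finset (ℕ × Fin 2)) → Fin k → Fin M :=
  fun p => H p.1.1 p.1.2 ω

lemma eq_of_past_eq {ω ω' : Ω} (h : past H t ω = past H t ω') {u : ℕ} (hu : u < t) (a : Fin 2) :
    H u a ω = H u a ω' :=
  congrFun h ⟨(u, a), by simpa using hu⟩

lemma bits_congr {h h' : ℕ → Fin 2 → Fin k → Fin M} {t : ℕ} (hh : ∀ u < t, h u = h' u) :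
    bits σ r h t = bits σ r h' t := by
  induction t with
  | zero => rfl
  | succ t ih => rw [bits, bits, ih fun u hu => hh u (by omega), hh t (by omega)]

lemma bits_eq_of_past_eq {ω ω' : Ω} (h : past H t ω = past H t ω') {u : ℕ} (hu : u ≤ t) :
    bits σ r (fun v a => H v a ω) u = bits σ r (fun v a => H v a ω') u :=
  bits_congr fun v hv => funext fun a => eq_of_past_eq h (by omega) a

lemma card_bits_le (hkσ : k ≤ σ) (h : ℕ → Fin 2 → Fin k → Fin M) (t : ℕ) :
    (bits σ r h t).card ≤ σ := by
  cases t with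
  | zero => simp [bits]
  | succ t => exact card_step_le hkσ _ _ _

end History

/-! ### Fresh hashes are independent of the past -/

section Past

variable {Ω : Type*} [MeasurableSpace Ω] {μ : Measure Ω} {c : Scheme} {r : Recycle}
  {M k σ : ℕ} {H : ℕ → Fin 2 → Ω → Fin k → Fin M} {t : ℕ}

lemma measurable_past (hm : ∀ t a, Measurable (H t a)) (t : ℕ) : Measurable (past H t) :=
  measurable_pi_lambda _ fun p => hm p.1.1 p.1.2

lemma measurable_of_factorsThrough_past {β : Type*} [MeasurableSpace β] [Nonempty β]
    (hm : ∀ t a, Measurable (H t a)) {f : Ω → β} (hf : f.FactorsThrough (past H t)) :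
    Measurable f := by
  obtain ⟨e, rfl⟩ := (Function.factorsThrough_iff f).1 hf
  exact (measurable_of_finite e).comp (measurable_past hm t)

lemma measurableSet_of_factorsThrough_past (hm : ∀ t a, Measurable (H t a)) {p : Ω → Prop}
    (hp : p.FactorsThrough (past H t)) : MeasurableSet {ω | p ω} :=
  measurableSet_setOfPred.2 (measurable_of_factorsThrough_past hm hp)

lemma measureReal_uniformOn_singleton {α : Type*} [MeasurableSpace α]
    [MeasurableSingletonClass α] [DecidableEq α] (s : Finset α) (x : α) :
    (uniformOn (s : Set α)).real {x} = if x ∈ s then (s.card : ℝ)⁻¹ else 0 := by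
  have h := uniformOn_apply_finset (s := s) (t := {x})
  rw [Finset.coe_singleton] at h
  rw [measureReal_def, h, Finset.inter_comm]
  by_cases hx : x ∈ s
  · simp [Finset.singleton_inter_of_mem hx, hx]
  · simp [Finset.singleton_inter_of_notMem hx, hx]

lemma indepFun_past (hm : ∀ t a, Measurable (H t a))
    (hind : iIndepFun (fun p : ℕ × Fin 2 => H p.1 p.2) μ) (t : ℕ) :
    IndepFun (past H t) (fun ω => (H t 0 ω, H t 1 ω)) μ := by
  have h := hind.indepFun_finset (Finset.range t ×ˢ (Finset.univ : Finset (Fin 2)))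
    ({t} ×ˢ (Finset.univ : Finset (Fin 2)))
    (Finset.disjoint_left.2 fun p hp hp' => by
      simp only [Finset.mem_product, Finset.mem_range, Finset.mem_univ, and_true,
        Finset.mem_singleton] at hp hp'
      omega) fun p => hm p.1 p.2
  refine h.comp (φ := id)
    (ψ := fun f : (({t} ×ˢ Finset.univ : Finset (ℕ × Fin 2)) → Fin k → Fin M) =>
      (f ⟨(t, 0), by simp⟩, f ⟨(t, 1), by simp⟩)) measurable_id ?_
  exact (measurable_pi_apply _).prodMk (measurable_pi_apply _)

lemma integral_map_hash_pair [IsProbabilityMeasure μ] (hm : ∀ t a, Measurable (H t a))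
    (hlaw : ∀ t a, μ.map (H t a) = uniformOn (hashes c M k : Set (Fin k → Fin M)))
    (hind : iIndepFun (fun p : ℕ × Fin 2 => H p.1 p.2) μ) (t : ℕ)
    (f : (Fin k → Fin M) × (Fin k → Fin M) → ℝ) :
    ∫ y, f y ∂(μ.map fun ω => (H t 0 ω, H t 1 ω)) = hashAvg c f := by
  classical
  have h01 : IndepFun (H t 0) (H t 1) μ :=
    hind.indepFun (i := (t, (0 : Fin 2))) (j := (t, (1 : Fin 2))) (by simp)
  rw [h01.map_prod_eq_prod_map_map (hm t 0).aemeasurable (hm t 1).aemeasurable, hlaw, hlaw]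
  have hprob : IsProbabilityMeasure (uniformOn (hashes c M k : Set (Fin k → Fin M))) := by
    rw [← hlaw 0 0]
    exact Measure.isProbabilityMeasure_map (hm 0 0).aemeasurable
  rw [integral_fintype Integrable.of_finite, hashAvg, Finset.sum_div,
    ← Finset.sum_subset (Finset.subset_univ (hashes c M k ×ˢ hashes c M k))]
  · refine Finset.sum_congr rfl fun y hy => ?_
    rw [Finset.mem_product] at hy
    rw [show ({y} : Set ((Fin k → Fin M) × (Fin k → Fin M))) = {y.1} ×ˢ {y.2} by simp,
      measureReal_prod_prod, measureReal_uniformOn_singleton, measureReal_uniformOn_singleton,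
      if_pos hy.1, if_pos hy.2, Finset.card_product, Nat.cast_mul, smul_eq_mul, ← mul_inv,
      mul_comm, div_eq_mul_inv]
  · intro y _ hy
    rw [show ({y} : Set ((Fin k → Fin M) × (Fin k → Fin M))) = {y.1} ×ˢ {y.2} by simp,
      measureReal_prod_prod, measureReal_uniformOn_singleton, measureReal_uniformOn_singleton]
    rw [Finset.mem_product, not_and_or] at hy
    rcases hy with hy | hy <;> simp [hy]

/-- The hashes of the message `t` may be averaged out of a quantity that otherwise depends on the
past only. -/
lemma integral_eq_integral_hashAvg [IsProbabilityMeasure μ] (hm : ∀ t a, Measurable (H t a))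
    (hlaw : ∀ t a, μ.map (H t a) = uniformOn (hashes c M k : Set (Fin k → Fin M)))
    (hind : iIndepFun (fun p : ℕ × Fin 2 => H p.1 p.2) μ)
    {F : Ω → (Fin k → Fin M) × (Fin k → Fin M) → ℝ} (hF : F.FactorsThrough (past H t)) :
    ∫ ω, F ω (H t 0 ω, H t 1 ω) ∂μ = ∫ ω, hashAvg c (F ω) ∂μ := by
  obtain ⟨G, rfl⟩ := (Function.factorsThrough_iff F).1 hF
  have hW : Measurable fun ω => (H t 0 ω, H t 1 ω) := (hm t 0).prodMk (hm t 1)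
  have hP := measurable_past hm t
  have hprob1 : IsProbabilityMeasure (μ.map (past H t)) :=
    Measure.isProbabilityMeasure_map hP.aemeasurable
  have hprob2 : IsProbabilityMeasure (μ.map fun ω => (H t 0 ω, H t 1 ω)) :=
    Measure.isProbabilityMeasure_map hW.aemeasurable
  have hG : StronglyMeasurable (Function.uncurry G) :=
    (measurable_of_finite _).stronglyMeasurable
  calc ∫ ω, (G ∘ past H t) ω (H t 0 ω, H t 1 ω) ∂μ
      = ∫ z, Function.uncurry G z ∂(μ.map fun ω => (past H t ω, (H t 0 ω, H t 1 ω))) :=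
        (integral_map (hP.prodMk hW).aemeasurable hG.aestronglyMeasurable).symm
    _ = ∫ x, ∫ y, G x y ∂(μ.map fun ω => (H t 0 ω, H t 1 ω)) ∂(μ.map (past H t)) := by
        rw [(indepFun_past hm hind t).map_prod_eq_prod_map_map hP.aemeasurable hW.aemeasurable,
          integral_prod _ Integrable.of_finite]
        rfl
    _ = ∫ x, hashAvg c (G x) ∂(μ.map (past H t)) := by
        simp only [integral_map_hash_pair hm hlaw hind]
    _ = ∫ ω, hashAvg c ((G ∘ past H t) ω) ∂μ :=
        integral_map hP.aemeasurable
          (measurable_of_finite _).stronglyMeasurable.aestronglyMeasurable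

/-! ### The Markov chain of the number of set bits -/

lemma integral_ite_const {Ω : Type*} [MeasurableSpace Ω] {μ : Measure Ω} {p : Ω → Prop}
    [DecidablePred p] (hp : MeasurableSet {ω | p ω}) (a : ℝ) :
    ∫ ω, (if p ω then a else 0) ∂μ = μ.real {ω | p ω} * a := by
  have h : (fun ω => if p ω then a else 0) = {ω | p ω}.indicator fun _ => a := by
    ext ω
    simp [Set.indicator_apply]
  rw [h, integral_indicator_const _ hp, smul_eq_mul]

lemma isMarkovChain_card_bits [IsProbabilityMeasure μ] (hm : ∀ t a, Measurable (H t a))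
    (hlaw : ∀ t a, μ.map (H t a) = uniformOn (hashes c M k : Set (Fin k → Fin M)))
    (hind : iIndepFun (fun p : ℕ × Fin 2 => H p.1 p.2) μ) :
    IsMarkovChain μ (fun t ω => (bits σ r (fun u a => H u a ω) t).card) (tau c r M σ k) := by
  classical
  intro t s j
  set B : ℕ → Ω → Finset (Fin M) := fun t ω => bits σ r (fun u a => H u a ω) t with hB
  set A : Ω → Prop := fun ω => ∀ u ≤ t, (B u ω).card = s u with hA
  have hAfac : A.FactorsThrough (past H t) := by
    intro ω ω' h
    refine propext (forall₂_congr fun u hu => ?_)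
    simp only [hB, bits_eq_of_past_eq h hu]
  have hjoint : MeasurableSet {ω | (B (t + 1) ω).card = j ∧ A ω} := by
    refine measurableSet_of_factorsThrough_past (t := t + 1) hm fun ω ω' h => ?_
    refine congrArg₂ And ?_ (propext (forall₂_congr fun u hu => ?_))
    · simp only [hB, bits_eq_of_past_eq h le_rfl]
    · simp only [hB, bits_eq_of_past_eq h (show u ≤ t + 1 by omega)]
  have hfresh := integral_eq_integral_hashAvg hm hlaw hind (t := t)
    (F := fun ω y => (if A ω then 1 else 0) *
      if (step σ r (B t ω) y.1 y.2).card = j then 1 else 0) (by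
      intro ω ω' h
      simp only [hAfac h, hB, bits_eq_of_past_eq h le_rfl])
  simp only [hashAvg_const_mul, hashAvg_step_card_eq, moveProb_eq_tau] at hfresh
  have hleft : ∀ ω, ((if A ω then 1 else 0) *
      if (step σ r (B t ω) (H t 0 ω) (H t 1 ω)).card = j then 1 else 0 : ℝ) =
      if (B (t + 1) ω).card = j ∧ A ω then 1 else 0 := by
    intro ω
    rw [show step σ r (B t ω) (H t 0 ω) (H t 1 ω) = B (t + 1) ω from rfl, ite_and]
    split_ifs <;> simp
  have hright : ∀ ω, ((if A ω then 1 else 0) * tau c r M σ k (B t ω).card j : ℝ) =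
      if A ω then tau c r M σ k (s t) j else 0 := by
    intro ω
    by_cases h : A ω
    · simp [h, h t le_rfl]
    · simp [h]
  simp only [hleft, hright] at hfresh
  rw [integral_ite_const hjoint, integral_ite_const
    (measurableSet_of_factorsThrough_past hm hAfac), mul_one] at hfresh
  exact hfresh

end Past


/-! ### The long-run false-positive rate -/

section LongRun

variable {Ω : Type*} [MeasurableSpace Ω] {μ : Measure Ω} [IsProbabilityMeasure μ]
  {c : Scheme} {r : Recycle} {M k σ : ℕ} {H : ℕ → Fin 2 → Ω → Fin k → Fin M}

lemma measureReal_isFalsePositive_and (hkM : k ≤ M) (hm : ∀ t a, Measurable (H t a))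
    (hlaw : ∀ t a, μ.map (H t a) = uniformOn (hashes c M k : Set (Fin k → Fin M)))
    (hind : iIndepFun (fun p : ℕ × Fin 2 => H p.1 p.2) μ) (t i : ℕ) :
    μ.real {ω | IsFalsePositive σ r (fun u a => H u a ω) t ∧
        (bits σ r (fun u a => H u a ω) t).card = i} =
      μ.real {ω | (bits σ r (fun u a => H u a ω) t).card = i} * rho c M k i := by
  classical
  set B : Ω → Finset (Fin M) := fun ω => bits σ r (fun u a => H u a ω) t with hB
  have hjoint : MeasurableSet {ω | positions (H t 0 ω) ⊆ B ω ∧ (B ω).card = i} := by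
    refine measurableSet_of_factorsThrough_past (t := t + 1) hm fun ω ω' h => ?_
    simp only [hB, bits_eq_of_past_eq h t.le_succ, eq_of_past_eq h t.lt_succ_self]
  have hset : MeasurableSet {ω | (B ω).card = i} := by
    refine measurableSet_of_factorsThrough_past (t := t) hm fun ω ω' h => ?_
    simp only [hB, bits_eq_of_past_eq h le_rfl]
  have hfresh := integral_eq_integral_hashAvg hm hlaw hind (t := t)
    (F := fun ω y => (if (B ω).card = i then 1 else 0) *
      if positions y.1 ⊆ B ω then 1 else 0) (by
      intro ω ω' h
      simp only [hB, bits_eq_of_past_eq h le_rfl])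
  have havg : ∀ S : Finset (Fin M),
      hashAvg c (fun y : (Fin k → Fin M) × (Fin k → Fin M) =>
        if positions y.1 ⊆ S then (1 : ℝ) else 0) = rho c M k S.card := fun S => by
    rw [hashAvg_boole_fst fun h => positions h ⊆ S, hashProb_positions_subset hkM]
  simp only [hashAvg_const_mul, havg] at hfresh
  have hleft : ∀ ω, ((if (B ω).card = i then 1 else 0) *
      if positions (H t 0 ω) ⊆ B ω then 1 else 0 : ℝ) =
      if positions (H t 0 ω) ⊆ B ω ∧ (B ω).card = i then 1 else 0 := by
    intro ω
    rw [ite_and]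
    split_ifs <;> simp
  have hright : ∀ ω, ((if (B ω).card = i then 1 else 0) * rho c M k (B ω).card : ℝ) =
      if (B ω).card = i then rho c M k i else 0 := by
    intro ω
    by_cases h : (B ω).card = i <;> simp [h]
  simp only [hleft, hright] at hfresh
  rw [integral_ite_const hjoint, integral_ite_const hset, mul_one] at hfresh
  exact hfresh

lemma measurableSet_card_bits (hm : ∀ t a, Measurable (H t a)) (t i : ℕ) :
    MeasurableSet {ω | (bits σ r (fun u a => H u a ω) t).card = i} :=
  measurableSet_of_factorsThrough_past (t := t) hm fun ω ω' h => by
    simp only [bits_eq_of_past_eq h le_rfl]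

lemma measureReal_card_bits_succ (hkσ : k ≤ σ) (hm : ∀ t a, Measurable (H t a))
    (hlaw : ∀ t a, μ.map (H t a) = uniformOn (hashes c M k : Set (Fin k → Fin M)))
    (hind : iIndepFun (fun p : ℕ × Fin 2 => H p.1 p.2) μ) (t j : ℕ) :
    μ.real {ω | (bits σ r (fun u a => H u a ω) (t + 1)).card = j} =
      ∑ i : Fin (σ + 1),
        μ.real {ω | (bits σ r (fun u a => H u a ω) t).card = i} * tau c r M σ k i j := by
  set B : ℕ → Ω → Finset (Fin M) := fun t ω => bits σ r (fun u a => H u a ω) t with hB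
  have hfresh := integral_eq_integral_hashAvg hm hlaw hind (t := t)
    (F := fun ω y => if (step σ r (B t ω) y.1 y.2).card = j then 1 else 0) (by
      intro ω ω' h
      simp only [hB, bits_eq_of_past_eq h le_rfl])
  simp only [hashAvg_step_card_eq, moveProb_eq_tau] at hfresh
  have hright : ∀ ω, tau c r M σ k (B t ω).card j =
      ∑ i : Fin (σ + 1), if (B t ω).card = i then tau c r M σ k i j else 0 := by
    intro ω
    have hlt : (B t ω).card < σ + 1 := Nat.lt_succ_of_le (card_bits_le hkσ _ t)
    rw [Finset.sum_eq_single (⟨(B t ω).card, hlt⟩ : Fin (σ + 1))]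
    · simp
    · intro i _ hi
      rw [if_neg]
      rintro h
      exact hi (Fin.ext h.symm)
    · simp
  have hint : ∀ i : Fin (σ + 1), Integrable
      (fun ω => if (B t ω).card = i then tau c r M σ k i j else 0) μ := fun i =>
    integrable_of_abs_le (Measurable.ite (measurableSet_card_bits hm t i) measurable_const
      measurable_const) (C := |tau c r M σ k i j|) fun ω => by
        split_ifs <;> simp
  simp only [hright] at hfresh
  rw [integral_finsetSum _ fun i _ => hint i] at hfresh
  refine ((integral_ite_const (measurableSet_card_bits hm (t + 1) j) 1).trans
    (mul_one _)).symm.trans (hfresh.trans (Finset.sum_congr rfl fun i _ => ?_))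
  exact integral_ite_const (measurableSet_card_bits hm t i) _

/-- The law of the number of set bits after `t` messages is the row vector `e₀ Pᵗ`. -/
lemma measureReal_card_bits (hkσ : k ≤ σ) (hm : ∀ t a, Measurable (H t a))
    (hlaw : ∀ t a, μ.map (H t a) = uniformOn (hashes c M k : Set (Fin k → Fin M)))
    (hind : iIndepFun (fun p : ℕ × Fin 2 => H p.1 p.2) μ) (t : ℕ) :
    (fun j : Fin (σ + 1) => μ.real {ω | (bits σ r (fun u a => H u a ω) t).card = (j : ℕ)}) =
      Matrix.vecMul (Pi.single 0 1) (transition c r M σ k ^ t) := by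
  induction t with
  | zero =>
    ext j
    rw [pow_zero, Matrix.vecMul_one]
    by_cases hj : j = 0
    · subst hj
      simp [bits]
    · have hj' : ¬ (0 = (j : ℕ)) := fun h => hj (Fin.ext h.symm)
      simp [bits, hj, hj']
  | succ t ih =>
    rw [pow_succ, ← Matrix.vecMul_vecMul, ← ih]
    ext j
    rw [measureReal_card_bits_succ hkσ hm hlaw hind]
    rfl

/-- If `g` solves the Poisson equation `g - P g = ρ - f` on the states `0, …, σ`, then the false
positives, corrected by `f` and by the increments of `g` along the chain, form a bounded sequence
of martingale differences. The increments of `g` telescope, and so the fraction of false positives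
tends to `f`. -/
lemma ae_tendsto_falsePositiveFraction_of_poisson (hkσ : k ≤ σ) (hkM : k ≤ M)
    (hm : ∀ t a, Measurable (H t a))
    (hlaw : ∀ t a, μ.map (H t a) = uniformOn (hashes c M k : Set (Fin k → Fin M)))
    (hind : iIndepFun (fun p : ℕ × Fin 2 => H p.1 p.2) μ) {f : ℝ} {g : ℕ → ℝ}
    (hg : ∀ i ≤ σ, g i - ∑ j : Fin (σ + 1), tau c r M σ k i j * g j = rho c M k i - f) :
    ∀ᵐ ω ∂μ, Tendsto (fun n => falsePositiveFraction σ r (fun u a => H u a ω) n) atTop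
      (𝓝 f) := by
  classical
  set B : ℕ → Ω → Finset (Fin M) := fun t ω => bits σ r (fun u a => H u a ω) t with hB
  set G : Finset (Fin M) → (Fin k → Fin M) × (Fin k → Fin M) → ℝ := fun S y =>
    (if positions y.1 ⊆ S then 1 else 0) + (g (step σ r S y.1 y.2).card + (-f - g S.card)) with hG
  set D : ℕ → Ω → ℝ := fun t ω => G (B t ω) (H t 0 ω, H t 1 ω) with hD
  have havg : ∀ S : Finset (Fin M), S.card ≤ σ → hashAvg c (G S) = 0 := by
    intro S hS
    rw [hG, hashAvg_add, hashAvg_add, hashAvg_const hkM,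
      hashAvg_boole_fst fun h => positions h ⊆ S, hashProb_positions_subset hkM,
      hashAvg_step_card hkσ]
    simp only [moveProb_eq_tau]
    linarith [hg _ hS]
  have hDfac : ∀ s t, s < t → (D s).FactorsThrough (past H t) := by
    intro s t hst ω ω' h
    simp only [hD, hB, bits_eq_of_past_eq h hst.le, eq_of_past_eq h hst]
  have hDm : ∀ t, Measurable (D t) := fun t =>
    measurable_of_factorsThrough_past hm (hDfac t (t + 1) t.lt_succ_self)
  obtain ⟨C, hC⟩ := (Set.finite_range fun p : Finset (Fin M) × _ × _ => |G p.1 p.2|).bddAbove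
  have hDC : ∀ t ω, |D t ω| ≤ C := fun t ω => hC ⟨(B t ω, H t 0 ω, H t 1 ω), rfl⟩
  have horth : ∀ s t, s < t → ∫ ω, D s ω * D t ω ∂μ = 0 := by
    intro s t hst
    have hfresh := integral_eq_integral_hashAvg hm hlaw hind (t := t)
      (F := fun ω y => D s ω * G (B t ω) y) (by
        intro ω ω' h
        simp only [hDfac s t hst h, hB, bits_eq_of_past_eq h le_rfl])
    refine hfresh.trans ?_
    simp only [hashAvg_const_mul]
    simp [havg _ (card_bits_le hkσ _ t), hB]
  filter_upwards [ae_tendsto_average_of_orthogonal hDm hDC horth] with ω hω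
  have hsum : ∀ n, ∑ t ∈ Finset.range n, D t ω =
      (((Finset.range n).filter (IsFalsePositive σ r fun u a => H u a ω)).card : ℝ) - n * f +
        (g (B n ω).card - g (B 0 ω).card) := by
    intro n
    have hterm : ∀ t, D t ω = (if IsFalsePositive σ r (fun u a => H u a ω) t then 1 else 0) - f +
        (g (B (t + 1) ω).card - g (B t ω).card) := by
      intro t
      rw [show B (t + 1) ω = step σ r (B t ω) (H t 0 ω) (H t 1 ω) from rfl]
      by_cases h : positions (H t 0 ω) ⊆ B t ω
      · have h' : IsFalsePositive σ r (fun u a => H u a ω) t := h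
        simp only [hD, hG, if_pos h, if_pos h']
        ring
      · have h' : ¬ IsFalsePositive σ r (fun u a => H u a ω) t := h
        simp only [hD, hG, if_neg h, if_neg h']
        ring
    rw [Finset.sum_congr rfl fun t _ => hterm t, Finset.sum_add_distrib, Finset.sum_sub_distrib,
      Finset.sum_boole, Finset.sum_range_sub fun t => g (B t ω).card]
    simp
  obtain ⟨K, hK⟩ := (Set.finite_range fun S : Finset (Fin M) => |g S.card|).bddAbove
  have htel : Tendsto (fun n : ℕ => (g (B n ω).card - g (B 0 ω).card) / (n : ℝ)) atTop (𝓝 0) := by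
    refine squeeze_zero_norm (fun n => ?_) (tendsto_const_div_atTop_nhds_zero_nat (2 * K))
    rw [Real.norm_eq_abs, abs_div, Nat.abs_cast]
    gcongr
    have h1 : |g (B n ω).card| ≤ K := hK ⟨B n ω, rfl⟩
    have h2 : |g (B 0 ω).card| ≤ K := hK ⟨B 0 ω, rfl⟩
    linarith [abs_sub (g (B n ω).card) (g (B 0 ω).card)]
  have hlim := (hω.add_const f).sub htel
  simp only [zero_add, sub_zero] at hlim
  refine hlim.congr' ?_
  filter_upwards [eventually_gt_atTop 0] with n hn
  have hn' : (n : ℝ) ≠ 0 := by exact_mod_cast hn.ne'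
  rw [hsum]
  have hfrac : falsePositiveFraction σ r (fun u a => H u a ω) n =
      (((Finset.range n).filter (IsFalsePositive σ r fun u a => H u a ω)).card : ℝ) / n := by
    unfold falsePositiveFraction
    congr!
  rw [hfrac]
  field_simp
  ring

/-- Ergodic behaviour of the filter: the number of set bits has exactly one stationary
distribution, it converges to it in law, and the fraction of false positives converges to the
stationary mean of the state-dependent rate. -/
lemma exists_stationary_and_tendsto (hk : 1 ≤ k) (hkσ : k ≤ σ) (hσM : σ ≤ M)
    (hm : ∀ t a, Measurable (H t a))
    (hlaw : ∀ t a, μ.map (H t a) = uniformOn (hashes c M k : Set (Fin k → Fin M)))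
    (hind : iIndepFun (fun p : ℕ × Fin 2 => H p.1 p.2) μ) :
    ∃ w : Fin (σ + 1) → ℝ,
      IsStationary (tau c r M σ k) w ∧
      (∀ w' : Fin (σ + 1) → ℝ, IsStationary (tau c r M σ k) w' → w' = w) ∧
      (∀ i : Fin (σ + 1), Tendsto
        (fun t => μ.real {ω | (bits σ r (fun u a => H u a ω) t).card = (i : ℕ)}) atTop
        (𝓝 (w i))) ∧
      ∀ᵐ ω ∂μ, Tendsto (fun n => falsePositiveFraction σ r (fun u a => H u a ω) n) atTop
        (𝓝 (∑ i, w i * rho c M k i)) := by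
  have hP := transition_mem_rowStochastic (c := c) (r := r) hkσ hσM
  have hN := transition_pow_pos (c := c) (r := r) hk hkσ hσM
  obtain ⟨w, hw0, hw1, hwP⟩ := exists_stationary hP hN
  refine ⟨w, isStationary_iff.2 ⟨hw0, hw1, hwP⟩, fun w' hw' => ?_, fun i => ?_, ?_⟩
  · obtain ⟨-, hw1', hwP'⟩ := isStationary_iff.1 hw'
    refine sub_eq_zero.1 (eq_zero_of_vecMul_eq_self hP hN ?_ ?_)
    · simp [hw1, hw1']
    · rw [Matrix.sub_vecMul, hwP, hwP']
  · have h := tendsto_vecMul_pow hP hN hw1 hwP (p := Pi.single 0 1) (by simp) i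
    exact h.congr fun t => (congrFun (measureReal_card_bits hkσ hm hlaw hind t) i).symm
  · obtain ⟨g, hg⟩ := exists_poisson hP hN hw1 hwP fun i => rho c M k i
    refine ae_tendsto_falsePositiveFraction_of_poisson hkσ (hkσ.trans hσM) hm hlaw hind
      (g := fun i => if h : i < σ + 1 then g ⟨i, h⟩ else 0) fun i hi => ?_
    have hval : ∀ j : Fin (σ + 1), (if h : (j : ℕ) < σ + 1 then g ⟨j, h⟩ else 0) = g j :=
      fun j => dif_pos j.2
    simp only [hval, dif_pos (Nat.lt_succ_of_le hi)]
    exact hg ⟨i, Nat.lt_succ_of_le hi⟩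

end LongRun

end RBF

open RBF in
theorem mainTheorem1 (M k σ : ℕ) (hk : 1 ≤ k) (hkσ : k ≤ σ) (hσM : σ < M)
    {Ω : Type*} [MeasurableSpace Ω] (μ : Measure Ω) [IsProbabilityMeasure μ] :
    -- the transition law of the number of set bits depends on this number only
    (∀ c r,
      (∀ S : Finset (Fin M), S.card ≤ σ → ∀ j, moveProb c r σ k S j = tau c r M σ k S.card j) ∧
      (∀ i ≤ σ, ∑ j ∈ Finset.range (σ + 1), tau c r M σ k i j = 1)) ∧
    -- base cases, all versions
    (∀ c r,
      (∀ i ≤ σ, ∀ j ≤ σ, tau c r M σ 0 i j = if i = j then 1 else 0) ∧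
      tau c r M σ k 0 0 = 0 ∧
      (∀ i ≤ σ, ∀ j ≤ σ, i + k < j → tau c r M σ k i j = 0)) ∧
    -- forward recursion, colliding
    (∀ r, (r = .forget ∨ 2 * k ≤ σ) → ∀ i ≤ σ, ∀ j ≤ σ, i ≤ j → 1 ≤ j →
      tau .colliding r M σ k i j =
        tau .colliding r M σ (k - 1) i j * ((j : ℝ) / M) +
        tau .colliding r M σ (k - 1) i (j - 1) * (((M : ℝ) - j + 1) / M)) ∧
    -- forward recursion, non-colliding
    (∀ r, (r = .forget ∨ 2 * k ≤ σ) → ∀ i ≤ σ, ∀ j ≤ σ, i ≤ j → 1 ≤ j →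
      tau .nonColliding r M σ k i j =
        tau .nonColliding r M σ (k - 1) i j * (((j : ℝ) - ((k : ℝ) - 1)) / ((M : ℝ) - ((k : ℝ) - 1))) +
        tau .nonColliding r M σ (k - 1) i (j - 1) *
          (((M : ℝ) - j + 1) / ((M : ℝ) - ((k : ℝ) - 1)))) ∧
    -- backward transitions, colliding and non-retaining
    (∀ i ≤ σ, 1 ≤ i →
      tau .colliding .forget M σ k i 0 =
        tau .colliding .forget M σ (k - 1) i 0 +
        tau .colliding .forget M σ (k - 1) i σ * (((M : ℝ) - σ) / M)) ∧
    -- backward transitions, non-colliding and non-retaining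
    (∀ i ≤ σ, 1 ≤ i →
      tau .nonColliding .forget M σ k i 0 =
        tau .nonColliding .forget M σ (k - 1) i 0 +
        tau .nonColliding .forget M σ (k - 1) i σ * (((M : ℝ) - σ) / ((M : ℝ) - ((k : ℝ) - 1)))) ∧
    (∀ r, tau .nonColliding r M σ k 0 k = 1) ∧
    -- no other backward transitions without retention
    (∀ c, ∀ i ≤ σ, ∀ j, 1 ≤ j → j < i → tau c .forget M σ k i j = 0) ∧
    -- backward transitions, colliding and retaining
    (∀ i ≤ σ, ∀ j ≤ k, k < i →
      tau .colliding .rehash M σ k i j =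
          tau .colliding .forget M σ k i 0 * tau .colliding .forget M σ k 0 j ∧
      tau .colliding .keep M σ k i j =
          tau .nonColliding .forget M σ j i 0 * tau .colliding .forget M σ k 0 j) ∧
    -- backward transitions, non-colliding and retaining
    (∀ r, r ≠ .forget → ∀ i ≤ σ, k < i →
      tau .nonColliding r M σ k i k = tau .nonColliding .forget M σ k i 0 ∧
      ∀ j < k, tau .nonColliding r M σ k i j = 0) ∧
    -- no other backward transitions with retention
    (∀ c r, r ≠ .forget →
      (∀ i ≤ σ, tau c r M σ k i 0 = 0) ∧
      (∀ i ≤ σ, ∀ j, k < j → j < i → tau c r M σ k i j = 0) ∧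
      (2 * k ≤ σ → ∀ i ≤ k, ∀ j < i, tau c r M σ k i j = 0)) ∧
    -- the Markov chain and the long-run false-positive rate
    (∀ (c : Scheme) (r : Recycle) (H : ℕ → Fin 2 → Ω → Fin k → Fin M),
      (∀ t a, Measurable (H t a)) →
      (∀ t a, μ.map (H t a) = uniformOn (hashes c M k : Set (Fin k → Fin M))) →
      iIndepFun (fun p : ℕ × Fin 2 => H p.1 p.2) μ →
      let B : ℕ → Ω → Finset (Fin M) := fun t ω => bits σ r (fun u a => H u a ω) t
      (∀ t ω, (B t ω).card ≤ σ) ∧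
      IsMarkovChain μ (fun t ω => (B t ω).card) (tau c r M σ k) ∧
      -- the false-positive rate in state `i`
      (∀ t i, μ.real {ω | IsFalsePositive σ r (fun u a => H u a ω) t ∧ (B t ω).card = i} =
        μ.real {ω | (B t ω).card = i} * rho c M k i) ∧
      ∃ π : Fin (σ + 1) → ℝ,
        IsStationary (tau c r M σ k) π ∧
        (∀ π' : Fin (σ + 1) → ℝ, IsStationary (tau c r M σ k) π' → π' = π) ∧
        (∀ i : Fin (σ + 1),
          Tendsto (fun t => μ.real {ω | (B t ω).card = (i : ℕ)}) atTop (𝓝 (π i))) ∧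
        ∀ᵐ ω ∂μ, Tendsto (fun n => falsePositiveFraction σ r (fun u a => H u a ω) n) atTop
          (𝓝 (∑ i, π i * rho c M k i))) := by
  have hM : σ ≤ M := hσM.le
  obtain ⟨k, rfl⟩ : ∃ m, k = m + 1 := ⟨k - 1, by omega⟩
  simp only [Nat.add_sub_cancel, Nat.cast_add, Nat.cast_one, add_sub_cancel_right]
  refine ⟨fun c r => ⟨fun S _ j => moveProb_eq_tau j, fun i _ => sum_moveProb hkσ (by omega) _⟩,
    fun c r => ⟨fun i hi j _ => tau_zero_hashes hM hi, tau_zero_zero hk hkσ,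
      fun i hi j _ hij => tau_eq_zero_of_add_lt hM hi hij⟩,
    fun r hr i hi j hj hij hj1 => ?_, fun r hr i hi j hj hij hj1 => ?_, fun i hi hi1 => ?_,
    fun i hi hi1 => ?_, fun r => tau_nonColliding_zero_self hkσ hM,
    fun c i hi j hj1 hji => tau_forget_eq_zero hM hi hj1 hji,
    fun i hi j hj hki => ⟨tau_rehash_eq_mul hkσ hM hi (by omega),
      tau_keep_eq_mul hkσ hM hi hj (by omega)⟩,
    fun r hr i hi hki => ⟨tau_nonColliding_retain_self hr hM hi hki,
      fun j hj => tau_nonColliding_retain_eq_zero hr hM hi hki hj⟩,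
    fun c r hr => ⟨fun i hi => tau_retain_zero hr hk hM hi,
      fun i hi j hkj hji => tau_eq_zero_of_lt_of_lt hM hi hkj hji,
      fun hk2 i hi j hji => tau_eq_zero_of_add_le hM (by omega) hji⟩,
    fun c r H hm hlaw hind => ⟨fun t ω => card_bits_le hkσ _ t,
      isMarkovChain_card_bits hm hlaw hind,
      fun t i => measureReal_isFalsePositive_and (hkσ.trans hM) hm hlaw hind t i,
      exists_stationary_and_tendsto hk hkσ hM hm hlaw hind⟩⟩
  · simpa [excluded] using tau_forward (c := .colliding) hkσ hσM hr hi hj hij hj1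
  · exact tau_forward (c := .nonColliding) hkσ hσM hr hi hj hij hj1
  · simpa [excluded] using tau_forget_zero_succ (c := .colliding) hkσ hσM hi hi1
  · exact tau_forget_zero_succ (c := .nonColliding) hkσ hσM hi hi1
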